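/- Let $n\ge 1$, $q,t\in\mathbb{C}^\ast$ with $|q|<1$, and let $s=(s_1,\ldots,s_n)\in(\mathbb{C}^\ast)^n$ satisfy $s_j/s_i\notin q^{\mathbb{Z}\setminus\{0\}}$ for $1\le i<j\le n$. Put $\theta(z;p)=(z;p)_\infty(p/z;p)_\infty$ with $(z;p)_\infty=\prod_{i\ge0}(1-p^iz)$. For $r=1,\ldots,n$ let $$\mathcal{E}^{(r)}_{x,s}(p)=\sum_{I\subseteq\{1,\ldots,n\},\,|I|=r}\Big(\prod_{i\in I}s_i\Big)\,\mathcal{B}_I(x;p)\prod_{i\in I}T_{q,x_i},\qquad \mathcal{B}_I(x;p)=\prod_{\substack{i<j\\ i\in I,\,j\notin I}}\frac{\theta(x_j/tx_i;p)}{\theta(x_j/x_i;p)}\prod_{\substack{i<j\\ i\notin I,\,j\in I}}\frac{\theta(tx_j/x_i;p)}{\theta(x_j/x_i;p)},$$ where $T_{q,x_i}$ is the shift $x_i\mapsto qx_i$; these are the modified elliptic Ruijsenaars operators, acting on $\mathbb{C}[[px_1/x_n,x_2/x_1,\ldots,x_n/x_{n-1}]]$, where $\mathbb{C}[[p]]$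 is contained in this ring through $p=(px_1/x_n)(x_2/x_1)\cdots(x_n/x_{n-1})$. The normalized Ruijsenaars function $f(x;s;p)=f(x;s;p|q,t)$ is the (unique) solution in this ring of the joint eigenvalue problem $$\mathcal{E}^{(r)}_{x,s}(p)f(x;s;p)=\varepsilon^{(r)}(s;p)f(x;s;p)\quad(r=1,\ldots,n),\qquad \varepsilon^{(r)}(s;p)\in\mathbb{C}[[p]],$$ whose constant term with respect to $x$ (an element of $\mathbb{C}[[p]]$) is $1$. Then: (1) $f(x_2,\ldots,x_n,px_1;\,s_2,\ldots,s_n,s_1;\,p)=f(x_1,\ldots,x_n;\,s_1,\ldots,s_n;\,p)$ as formal power series, where the left side is obtained by the substitution $px_1/x_n\mapsto x_2/x_1\mapsto x_3/x_2\mapsto\cdots\mapsto x_n/x_{n-1}\mapsto px_1/x_n$. (2) The same identity holds for the sums of the series at complex numbers: for all $p\in\mathbb{C}^\ast$ and $x\in(\mathbb{C}^\ast)^n$, the series $f(x_2,\ldots,x_n,px_1;s_2,\ldots,s_n,s_1;p)$ converges absolutely if and only if the series $f(x;s;p)$ does, and then the two sums are equal. (3) $\varepsilon^{(r)}(s_2,\ldots,s_n,s_1;p)=\varepsilon^{(r)}(s_1,\ldots,s_n;p)$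 for $r=1,\ldots,n$. -/

import Mathlib

namespace Ruijsenaars

noncomputable section

/- Conventions.  The coordinates `x₁, …, xₙ` and the parameters `s₁, …, sₙ` are indexed by `Fin n`
(from `0` to `n - 1`), with the cyclic addition of `Fin n`.  The ring
`ℂ⟦p x₁ / xₙ, x₂ / x₁, …, xₙ / xₙ₋₁⟧` is `MvPowerSeries (Fin n) ℂ`: the variable `X 0` stands for
`z₀ = p x₁ / xₙ` and, for `k ≠ 0`, the variable `X k` stands for `z_k = x_{k+1} / x_k`
(that is, `x k / x (k - 1)` in the indexing by `Fin n`).  In particular `z₀ z₁ ⋯ zₙ₋₁ = p`. -/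

variable {n : ℕ}

/-- The ring `ℂ⟦p x₁ / xₙ, x₂ / x₁, …, xₙ / xₙ₋₁⟧`. -/
abbrev AsympSeries (n : ℕ) : Type := MvPowerSeries (Fin n) ℂ

/-- The elliptic nome `p = z₀ z₁ ⋯ zₙ₋₁`. -/
def nome (n : ℕ) : AsympSeries n := ∏ k : Fin n, MvPowerSeries.X k

/-- For `i < j`, the ratio `x_j / x_i`, a product of consecutive variables. -/
def ratio (i j : Fin n) : AsympSeries n := ∏ k ∈ Finset.Ioc i j, MvPowerSeries.X k

/-- For `i < j`, the element `p x_i / x_j`, the product of the remaining variables. -/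
def coratio (i j : Fin n) : AsympSeries n := ∏ k ∈ (Finset.Ioc i j)ᶜ, MvPowerSeries.X k

/-- The infinite shifted factorial `(a; p)_∞ = ∏_{i ≥ 0} (1 - p ^ i a)` as a formal power series.
Since `p ^ i` only involves monomials of degree at least `i` (for `n ≥ 1`), the factors with
`i > deg β` do not contribute to the coefficient of `z ^ β`, and that coefficient is the one of
the partial product over `i ≤ deg β`. -/
def pochhammer (a : AsympSeries n) : AsympSeries n := fun β : Fin n →₀ ℕ =>
  MvPowerSeries.coeff β (∏ i ∈ Finset.range (β.degree + 1), (1 - nome n ^ i * a))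

/-- For `i < j` and `c ≠ 0`, the theta function
`θ(c x_j / x_i; p) = (c x_j / x_i; p)_∞ (c⁻¹ p x_i / x_j; p)_∞`. -/
def theta (c : ℂ) (i j : Fin n) : AsympSeries n :=
  pochhammer (MvPowerSeries.C c * ratio i j) * pochhammer (MvPowerSeries.C c⁻¹ * coratio i j)

/-- The coefficient `𝓑_I(x; p)`: the product of `θ(t⁻¹ x_j / x_i; p) / θ(x_j / x_i; p)` over the
pairs `i < j` with `i ∈ I`, `j ∉ I`, and of `θ(t x_j / x_i; p) / θ(x_j / x_i; p)` over the pairs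
`i < j` with `i ∉ I`, `j ∈ I`.  The denominators have constant coefficient `1`. -/
def opCoeff (t : ℂ) (I : Finset (Fin n)) : AsympSeries n :=
  (∏ i ∈ I, ∏ j ∈ Iᶜ with i < j, theta t⁻¹ i j * (theta 1 i j)⁻¹) *
    ∏ i ∈ Iᶜ, ∏ j ∈ I with i < j, theta t i j * (theta 1 i j)⁻¹

/-- The `q`-shift operator `T_{q,x}^I = ∏_{i ∈ I} T_{q,x_i}`, `T_{q,x_i} : x_i ↦ q x_i`.
The exponent of `x_i` in `z ^ β` is `β i - β (i + 1)` (cyclically). -/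
def qShift [NeZero n] (q : ℂ) (I : Finset (Fin n)) (f : AsympSeries n) : AsympSeries n :=
  fun β : Fin n →₀ ℕ => (∏ i ∈ I, q ^ ((β i : ℤ) - (β (i + 1) : ℤ))) * MvPowerSeries.coeff β f

/-- The modified elliptic Ruijsenaars operator
`𝓔^{(r)}_{x,s}(p) = ∑_{|I| = r} s^I 𝓑_I(x; p) T_{q,x}^I`. -/
def modifiedOp [NeZero n] (q t : ℂ) (s : Fin n → ℂ) (r : ℕ) (f : AsympSeries n) :
    AsympSeries n :=
  ∑ I ∈ (Finset.univ : Finset (Fin n)).powersetCard r,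
    MvPowerSeries.C (∏ i ∈ I, s i) * opCoeff t I * qShift q I f

/-- The inclusion of `ℂ⟦p⟧`, `∑ ε_k p ^ k ↦ ∑ ε_k (z₀ z₁ ⋯ zₙ₋₁) ^ k`. -/
def ofNomeSeries [NeZero n] (ε : PowerSeries ℂ) : AsympSeries n := fun β : Fin n →₀ ℕ =>
  if ∀ i, β i = β 0 then PowerSeries.coeff (β 0) ε else 0

/-- `f` is a normalized formal solution, with eigenvalues `ε r` (`r = 1, …, n`), of the joint
eigenvalue problem `𝓔^{(r)}_{x,s}(p) f = ε^{(r)} f`.  Normalized means that the constant term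
`∑_k p ^ k f_{k,k,…,k}` of `f` with respect to `x` is `1`. -/
structure IsNormalizedSolution [NeZero n] (q t : ℂ) (s : Fin n → ℂ) (f : AsympSeries n)
    (ε : ℕ → PowerSeries ℂ) : Prop where
  eigen : ∀ r ∈ Finset.Icc 1 n, modifiedOp q t s r f = ofNomeSeries (ε r) * f
  normalized : ∀ k : ℕ, MvPowerSeries.coeff (Finsupp.equivFunOnFinite.symm fun _ : Fin n => k) f =
    if k = 0 then 1 else 0

/-- The normalized solution together with its eigenvalues. -/
def solution [NeZero n] (q t : ℂ) (s : Fin n → ℂ) : AsympSeries n × (ℕ → PowerSeries ℂ) :=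
  Classical.epsilon fun u => IsNormalizedSolution q t s u.1 u.2

/-- The normalized Ruijsenaars function `f(x; s; p | q, t)` as a formal power series. -/
def series [NeZero n] (q t : ℂ) (s : Fin n → ℂ) : AsympSeries n := (solution q t s).1

/-- The eigenvalue `ε^{(r)}(s; p) ∈ ℂ⟦p⟧`, for `r = 1, …, n`. -/
def eigenvalue [NeZero n] (q t : ℂ) (s : Fin n → ℂ) (r : ℕ) : PowerSeries ℂ :=
  (solution q t s).2 r

theorem isNormalizedSolution_series [NeZero n] {q t : ℂ} {s : Fin n → ℂ}
    (h : ∃ f ε, IsNormalizedSolution q t s f ε) :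
    IsNormalizedSolution q t s (series q t s) (eigenvalue q t s) := by
  obtain ⟨f, ε, hf⟩ := h
  exact Classical.epsilon_spec
    (p := fun u : AsympSeries n × (ℕ → PowerSeries ℂ) => IsNormalizedSolution q t s u.1 u.2)
    ⟨(f, ε), hf⟩

/-- The numbers `z₀ = p x₁ / xₙ`, `z₁ = x₂ / x₁`, …, `zₙ₋₁ = xₙ / xₙ₋₁` at a point `x`. -/
def asympVar [NeZero n] (p : ℂ) (x : Fin n → ℂ) (k : Fin n) : ℂ :=
  if k = 0 then p * x 0 / x (-1) else x k / x (k - 1)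

/-- The term of index `β` of the series `f(x; s; p)` at numbers `x` and `p`. -/
def term [NeZero n] (q t : ℂ) (x s : Fin n → ℂ) (p : ℂ) (β : Fin n →₀ ℕ) : ℂ :=
  MvPowerSeries.coeff β (series q t s) * ∏ k, asympVar p x k ^ β k

/-- The value `f(x; s; p)` of the normalized Ruijsenaars function, the sum of its series. -/
def ruijsenaars [NeZero n] (q t : ℂ) (x s : Fin n → ℂ) (p : ℂ) : ℂ :=
  ∑' β : Fin n →₀ ℕ, term q t x s p β

/-- `(s₁, …, sₙ) ↦ (s₂, …, sₙ, s₁)`. -/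
def rotateParam [NeZero n] (s : Fin n → ℂ) : Fin n → ℂ := fun i => s (i + 1)

/-- `(x₁, …, xₙ) ↦ (x₂, …, xₙ, p x₁)`; the last index is the `i` with `i + 1 = 0`. -/
def rotatePoint [NeZero n] (p : ℂ) (x : Fin n → ℂ) : Fin n → ℂ := fun i =>
  if i + 1 = 0 then p * x 0 else x (i + 1)

/-- The substitution `f(x; p) ↦ f(x₂, …, xₙ, p x₁; p)` on formal power series.  It sends `z_k` to
`z_{k+1}` (cyclically), so the coefficient of `∏ z_k ^ β_k` in the result is the coefficient of
`∏ z_k ^ β_{k+1}` in `f`. -/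
def rotateSeries [NeZero n] (f : AsympSeries n) : AsympSeries n := fun β : Fin n →₀ ℕ =>
  MvPowerSeries.coeff (Finsupp.equivFunOnFinite.symm fun k : Fin n => β (k + 1)) f

end

end Ruijsenaars

/-! The rotation sends `z_k` to `z_{k+1}` cyclically and fixes `p`. Although `𝓑_I` is written with
the order of the indices, its factor for `i ∈ I`, `j ∉ I` is one expression `pairCoeff t 1 i j`,
whichever index is larger. It involves only the product of the variables on the cyclic arc from `i`
to `j` and the product on the complementary arc (`opCoeff_eq`). Hence the rotation carries `𝓑_I` to
`𝓑_{I+1}` and intertwines the operators for `(s₂, …, sₙ, s₁)` with those for `s`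
(`rotateHom_modifiedOp`). A rotated normalized solution is therefore a normalized solution for `s`.
Uniqueness gives the formal identity and the equality of eigenvalues, and the statement on sums is a
reindexing of the series.

Since `series` is a choice made by `Classical.epsilon`, existence of the joint solution is needed as
well as uniqueness. The operators are triangular on monomials, with diagonal entries the elementary
symmetric polynomials in `s_i q ^ l_i`, where `l` is the exponent in `x`. For generic `s`, some
linear combination of the operators distinguishes the monomials that are not powers of `p` from `1`.
It then has exactly one normalized eigenfunction `f`, found by recursion, and its eigenspace is
`ℂ⟦p⟧ f` (`eigenspace_eq`). Every commuting operator preserves that eigenspace, so existence reduces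
to commutativity of the `𝓔^{(r)}`.

Commutativity with `𝓔^{(1)}` comes down to a theta function identity (`sum_prod_thetaVal_eq`), an
instance of the partial fraction formula for theta functions with balanced arguments. It is proved
formally: a quasi-periodic series with too many prescribed zeros vanishes. General commutators are
handled indirectly. If `𝓔^{(1)}` separates all weights, its eigenfunction is a joint one, so every
commutator annihilates it; triangularity then forces the symbol of the commutator to vanish. The
symbol is polynomial in `s` and such `s` are plentiful, so it vanishes for all `s`
(`commSymbol_eq_zero`). -/

namespace Ruijsenaars

set_option linter.unusedSectionVars false
set_option linter.unusedSimpArgs false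

/-! ### Formal theta functions and quasi-periodicity -/

section FormalTheta

open PowerSeries LaurentPolynomial

variable {R S : Type*} [CommRing R] [CommRing S]

/-- The partial product `∏_{1 ≤ i ≤ N} (1 - a X ^ i)`. -/
noncomputable def eulerPartial (a : R) (N : ℕ) : PowerSeries R :=
  ∏ i ∈ Finset.range N, (1 - PowerSeries.C a * PowerSeries.X ^ (i + 1))

/-- The infinite product `∏_{i ≥ 1} (1 - a X ^ i)`. -/
noncomputable def eulerProd (a : R) : PowerSeries R :=
  PowerSeries.mk fun k => PowerSeries.coeff k (eulerPartial a k)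

theorem coeff_eulerProd (a : R) {k N : ℕ} (h : k ≤ N) :
    PowerSeries.coeff k (eulerProd a) = PowerSeries.coeff k (eulerPartial a N) := by
  induction N, h using Nat.le_induction with
  | base => simp [eulerProd]
  | succ N hN ih =>
    rw [ih, eulerPartial, eulerPartial, Finset.prod_range_succ, mul_sub, mul_one, map_sub,
      ← mul_assoc, PowerSeries.coeff_mul_X_pow', if_neg (by omega), sub_zero]

theorem map_eulerPartial (f : R →+* S) (a : R) (N : ℕ) :
    (eulerPartial a N).map f = eulerPartial (f a) N := by
  simp [eulerPartial, map_prod]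

theorem map_eulerProd (f : R →+* S) (a : R) : (eulerProd a).map f = eulerProd (f a) := by
  ext k
  simp [eulerProd, ← map_eulerPartial f a k]

theorem constantCoeff_eulerProd (a : R) : PowerSeries.constantCoeff (eulerProd a) = 1 := by
  rw [← PowerSeries.coeff_zero_eq_constantCoeff_apply, coeff_eulerProd a le_rfl]
  simp [eulerPartial]

/-- The theta function `θ(u; X) = (u; X)_∞ (X / u; X)_∞` at a unit `u`, a power series in the
nome `X`. -/
noncomputable def thetaSeries (u : Rˣ) : PowerSeries R :=
  (1 - PowerSeries.C (u : R)) * eulerProd (u : R) * eulerProd (↑u⁻¹ : R)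

theorem thetaSeries_one : thetaSeries (1 : Rˣ) = 0 := by simp [thetaSeries]

theorem thetaSeries_inv (u : Rˣ) :
    thetaSeries u⁻¹ = -(PowerSeries.C (↑u⁻¹ : R) * thetaSeries u) := by
  have h : PowerSeries.C (↑u⁻¹ : R) * PowerSeries.C (u : R) = 1 := by
    rw [← map_mul, Units.inv_mul, map_one]
  simp only [thetaSeries, inv_inv]
  linear_combination (-(eulerProd (u : R) * eulerProd (↑u⁻¹ : R))) * h

theorem map_thetaSeries (f : R →+* S) (u : Rˣ) :
    (thetaSeries u).map f = thetaSeries (Units.map f.toMonoidHom u) := by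
  simp only [thetaSeries, map_mul, map_sub, map_one, map_eulerProd, PowerSeries.map_C]
  rfl

theorem constantCoeff_thetaSeries (u : Rˣ) :
    PowerSeries.constantCoeff (thetaSeries u) = 1 - u := by
  simp [thetaSeries, constantCoeff_eulerProd]

/-- The coefficient of `X ^ k T ^ l`, for arbitrary integers `k` and `l`. -/
noncomputable def bicoeff (g : PowerSeries (LaurentPolynomial R)) (k l : ℤ) : R :=
  if 0 ≤ k then (PowerSeries.coeff k.toNat g).coeff l else 0

theorem bicoeff_natCast (g : PowerSeries (LaurentPolynomial R)) (k : ℕ) (l : ℤ) :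
    bicoeff g k l = (PowerSeries.coeff k g).coeff l := by simp [bicoeff]

theorem bicoeff_of_neg (g : PowerSeries (LaurentPolynomial R)) {k : ℤ} (hk : k < 0) (l : ℤ) :
    bicoeff g k l = 0 := by simp [bicoeff, not_le.2 hk]

theorem bicoeff_sub (g h : PowerSeries (LaurentPolynomial R)) (k l : ℤ) :
    bicoeff (g - h) k l = bicoeff g k l - bicoeff h k l := by
  unfold bicoeff; split_ifs <;> simp

theorem laurent_coeff_mul (f g : LaurentPolynomial R) (l : ℤ) (s : Finset ℤ)
    (hs : f.coeff.support ⊆ s) :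
    (f * g).coeff l = ∑ m ∈ s, f.coeff m * g.coeff (l - m) := by
  classical
  rw [AddMonoidAlgebra.coeff_mul, Finsupp.sum]
  refine Finset.sum_subset_zero_on_sdiff hs ?_ ?_
  · intro m hm
    simp [Finsupp.notMem_support_iff.1 (Finset.mem_sdiff.1 hm).2]
  · intro m _
    rw [Finsupp.sum, Finset.sum_eq_single (l - m)]
    · simp
    · intro b _ hb
      rw [if_neg]; intro h; apply hb; omega
    · intro h
      simp [Finsupp.notMem_support_iff.1 h]

/-- With coefficients extended by zero to negative powers of `X`, the product is a convolution on
the whole lattice `ℤ × ℤ`. The sum is finite because `0 ≤ x.1 ≤ k` leaves finitely many Laurent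
polynomials. In this form a shear of the lattice can be applied to it. -/
theorem bicoeff_mul (g h : PowerSeries (LaurentPolynomial R)) (k l : ℤ) :
    bicoeff (g * h) k l =
      ∑ᶠ x : ℤ × ℤ, bicoeff g x.1 x.2 * bicoeff h (k - x.1) (l - x.2) := by
  classical
  rcases lt_or_ge k 0 with hk | hk
  · rw [bicoeff_of_neg _ hk]
    symm
    apply finsum_eq_zero_of_forall_eq_zero
    intro x
    rcases lt_or_ge x.1 0 with hx | hx
    · rw [bicoeff_of_neg _ hx, zero_mul]
    · rw [bicoeff_of_neg h (by omega), mul_zero]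
  · lift k to ℕ using hk
    set s : Finset ℤ := (Finset.range (k + 1)).biUnion
      fun i => (PowerSeries.coeff i g).coeff.support with hs
    have hsub : ∀ i ∈ Finset.range (k + 1), (PowerSeries.coeff i g).coeff.support ⊆ s :=
      fun i hi => Finset.subset_biUnion_of_mem
        (fun i => (PowerSeries.coeff i g).coeff.support) hi
    rw [finsum_eq_sum_of_support_subset (s := ((Finset.range (k + 1)).map Nat.castEmbedding) ×ˢ s)]
    · rw [Finset.sum_product, Finset.sum_map, bicoeff_natCast, PowerSeries.coeff_mul,
        Finset.Nat.sum_antidiagonal_eq_sum_range_succ_mk, AddMonoidAlgebra.coeff_sum,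
        Finsupp.finsetSum_apply]
      refine Finset.sum_congr rfl fun i hi => ?_
      rw [laurent_coeff_mul _ _ _ s (hsub i hi)]
      refine Finset.sum_congr rfl fun m _ => ?_
      have hi' : i ≤ k := by simpa [Nat.lt_succ_iff] using hi
      have : ((k : ℤ) - Nat.castEmbedding i) = ((k - i : ℕ) : ℤ) := by
        simp [Nat.cast_sub hi']
      rw [this]
      simp [bicoeff_natCast]
    · intro x hx
      rcases lt_or_ge x.1 0 with h1 | h1
      · simp [bicoeff_of_neg g h1] at hx
      rcases lt_or_ge ((k : ℤ) - x.1) 0 with h2 | h2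
      · simp [bicoeff_of_neg h h2] at hx
      obtain ⟨a, b⟩ := x
      simp only at h1 h2 hx
      lift a to ℕ using h1
      have ha : a ∈ Finset.range (k + 1) := by simp; omega
      simp only [Finset.coe_product, Set.mem_prod, Finset.mem_coe]
      refine ⟨Finset.mem_map.2 ⟨a, ha, rfl⟩, hsub a ha ?_⟩
      rw [Finsupp.mem_support_iff]
      intro h0
      simp [bicoeff_natCast, h0] at hx

/-- The second series is obtained from the first by the substitution `T ↦ X T`. -/
def IsShift (g g' : PowerSeries (LaurentPolynomial R)) : Prop :=
  ∀ k l : ℤ, bicoeff g' k l = bicoeff g (k - l) l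

/-- The substitution `T ↦ X T` is not defined on every series, so it is treated as a relation. It is
multiplicative because it acts on exponents by a linear bijection of `ℤ × ℤ`. -/
theorem IsShift.mul {g g' h h' : PowerSeries (LaurentPolynomial R)} (hg : IsShift g g')
    (hh : IsShift h h') : IsShift (g * h) (g' * h') := by
  intro k l
  rw [bicoeff_mul, bicoeff_mul]
  let e : ℤ × ℤ ≃ ℤ × ℤ :=
    ⟨fun x => (x.1 - x.2, x.2), fun x => (x.1 + x.2, x.2), fun x => by simp, fun x => by simp⟩
  refine Eq.trans (finsum_congr fun x => ?_) (finsum_comp_equiv e)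
  simp only [e, Equiv.coe_fn_mk]
  rw [hg, hh, show k - x.1 - (l - x.2) = k - l - (x.1 - x.2) by ring]

theorem IsShift.sub {g g' h h' : PowerSeries (LaurentPolynomial R)} (hg : IsShift g g')
    (hh : IsShift h h') : IsShift (g - h) (g' - h') := by
  intro k l
  rw [bicoeff_sub, bicoeff_sub, hg, hh]

theorem isShift_monomial (c : R) {i j : ℕ} {m : ℤ} (h : (j : ℤ) = i + m) :
    IsShift (PowerSeries.monomial i (AddMonoidAlgebra.single m c : LaurentPolynomial R))
      (PowerSeries.monomial j (AddMonoidAlgebra.single m c)) := by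
  classical
  have key : ∀ (i : ℕ) (k l : ℤ),
      bicoeff (PowerSeries.monomial i (AddMonoidAlgebra.single m c : LaurentPolynomial R)) k l =
        if k = i ∧ l = m then c else 0 := by
    intro i k l
    rcases lt_or_ge k 0 with hk | hk
    · rw [bicoeff_of_neg _ hk, if_neg]; omega
    · lift k to ℕ using hk
      rw [bicoeff_natCast, PowerSeries.coeff_monomial]
      by_cases h1 : k = i
      · rw [if_pos h1, AddMonoidAlgebra.coeff_single]
        by_cases h2 : l = m
        · simp [h1, h2]
        · rw [Finsupp.single_eq_of_ne h2, if_neg fun h => h2 h.2]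
      · simp [h1]
  intro k l
  rw [key, key]
  refine if_congr ?_ rfl rfl
  constructor <;> rintro ⟨h1, h2⟩ <;> constructor <;> omega

theorem isShift_one : IsShift (1 : PowerSeries (LaurentPolynomial R)) 1 := by
  have := isShift_monomial (1 : R) (i := 0) (j := 0) (m := 0) (by simp)
  rwa [LaurentPolynomial.single_zero_one_eq_one, PowerSeries.monomial_zero_eq_C_apply, map_one]
    at this

theorem isShift_prod {ι : Type*} (s : Finset ι) (g g' : ι → PowerSeries (LaurentPolynomial R))
    (h : ∀ i ∈ s, IsShift (g i) (g' i)) : IsShift (∏ i ∈ s, g i) (∏ i ∈ s, g' i) := by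
  classical
  induction s using Finset.induction_on with
  | empty => simpa using isShift_one
  | insert i s hi ih =>
    rw [Finset.prod_insert hi, Finset.prod_insert hi]
    exact (h i (Finset.mem_insert_self _ _)).mul
      (ih fun j hj => h j (Finset.mem_insert_of_mem hj))

theorem isShift_const (f : PowerSeries R) :
    IsShift (f.map (LaurentPolynomial.C : R →+* LaurentPolynomial R)) (f.map LaurentPolynomial.C) := by
  have key : ∀ k l : ℤ, l ≠ 0 →
      bicoeff (f.map (LaurentPolynomial.C : R →+* LaurentPolynomial R)) k l = 0 := by
    intro k l hl
    unfold bicoeff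
    split_ifs
    · rw [PowerSeries.coeff_map, ← LaurentPolynomial.single_eq_C, AddMonoidAlgebra.coeff_single,
        Finsupp.single_eq_of_ne hl]
    · rfl
  intro k l
  by_cases hl : l = 0
  · simp [hl]
  · rw [key _ _ hl, key _ _ hl]

/-- The Laurent monomial `T / b`. -/
noncomputable def unitT (b : Rˣ) : (LaurentPolynomial R)ˣ where
  val := AddMonoidAlgebra.single 1 ↑b⁻¹
  inv := AddMonoidAlgebra.single (-1) ↑b
  val_inv := by simp [AddMonoidAlgebra.single_mul_single, -LaurentPolynomial.single_eq_C_mul_T,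
    AddMonoidAlgebra.one_def]
  inv_val := by simp [AddMonoidAlgebra.single_mul_single, -LaurentPolynomial.single_eq_C_mul_T,
    AddMonoidAlgebra.one_def]

theorem coeff_mul_congr {f f' g g' : PowerSeries R} {k : ℕ}
    (hf : ∀ j ≤ k, PowerSeries.coeff j f = PowerSeries.coeff j f')
    (hg : ∀ j ≤ k, PowerSeries.coeff j g = PowerSeries.coeff j g') :
    ∀ j ≤ k, PowerSeries.coeff j (f * g) = PowerSeries.coeff j (f' * g') := by
  intro j hj
  rw [PowerSeries.coeff_mul, PowerSeries.coeff_mul]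
  refine Finset.sum_congr rfl fun x hx => ?_
  have := Finset.HasAntidiagonal.mem_antidiagonal.1 hx
  rw [hf _ (by omega), hg _ (by omega)]

theorem coeff_thetaSeries (u : Rˣ) {k N M : ℕ} (hN : k ≤ N) (hM : k ≤ M) :
    ∀ j ≤ k, PowerSeries.coeff j (thetaSeries u) =
      PowerSeries.coeff j ((1 - PowerSeries.C (u : R)) * eulerPartial (u : R) N *
        eulerPartial (↑u⁻¹ : R) M) :=
  coeff_mul_congr (coeff_mul_congr (fun _ _ => rfl)
    fun _ h => coeff_eulerProd _ (h.trans hN)) fun _ h => coeff_eulerProd _ (h.trans hM)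

theorem isShift_one_sub (c : R) {i j : ℕ} {m : ℤ} (h : (j : ℤ) = i + m) :
    IsShift (1 - PowerSeries.C (AddMonoidAlgebra.single m c : LaurentPolynomial R) *
        PowerSeries.X ^ i)
      (1 - PowerSeries.C (AddMonoidAlgebra.single m c) * PowerSeries.X ^ j) := by
  have key : ∀ (i : ℕ) (a : LaurentPolynomial R),
      PowerSeries.C a * PowerSeries.X ^ i = PowerSeries.monomial i a := by
    intro i a
    rw [PowerSeries.X_pow_eq, ← PowerSeries.monomial_zero_eq_C_apply,
      PowerSeries.monomial_mul_monomial, zero_add, mul_one]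
  rw [key, key]
  exact isShift_one.sub (isShift_monomial c h)

/-- Under `v ↦ X v`, `w ↦ w / X` the first product loses its factor `1 - v` and gains one at the
top, while the second gains `1 - w = -w (1 - v)` and loses its top factor. Taking lengths `N` and `N
+ 1`, interchanged by the shift, makes the quasi-periodicity exact for the truncations. -/
theorem isShift_eulerPartial (a b : R) (N : ℕ) {v w : LaurentPolynomial R}
    (hv : v = AddMonoidAlgebra.single 1 a) (hw : w = AddMonoidAlgebra.single (-1) b)
    (hwv : w * v = 1) :
    IsShift ((1 - PowerSeries.C v) * eulerPartial v N * eulerPartial w (N + 1))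
      (PowerSeries.C (-w) * ((1 - PowerSeries.C v) * eulerPartial v (N + 1) *
        eulerPartial w N)) := by
  have h1 : IsShift (1 - PowerSeries.C v) (1 - PowerSeries.C v * PowerSeries.X ^ 1) := by
    have := isShift_one_sub a (i := 0) (j := 1) (m := 1) (by simp)
    rwa [pow_zero, mul_one, ← hv] at this
  have h2 : IsShift (eulerPartial v N)
      (∏ i ∈ Finset.range N, (1 - PowerSeries.C v * PowerSeries.X ^ (i + 1 + 1))) :=
    isShift_prod _ _ _ fun i _ => by
      rw [hv]; exact isShift_one_sub a (by push_cast; ring)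
  have h3 : IsShift (eulerPartial w (N + 1))
      (∏ i ∈ Finset.range (N + 1), (1 - PowerSeries.C w * PowerSeries.X ^ i)) :=
    isShift_prod _ _ _ fun i _ => by
      rw [hw]; exact isShift_one_sub b (by push_cast; ring)
  have e1 : (1 - PowerSeries.C v * PowerSeries.X ^ 1) *
      (∏ i ∈ Finset.range N, (1 - PowerSeries.C v * PowerSeries.X ^ (i + 1 + 1))) =
        eulerPartial v (N + 1) := by
    rw [eulerPartial, Finset.prod_range_succ', mul_comm]
  have e2 : (∏ i ∈ Finset.range (N + 1), (1 - PowerSeries.C w * PowerSeries.X ^ i)) =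
      eulerPartial w N * (1 - PowerSeries.C w) := by
    rw [eulerPartial, Finset.prod_range_succ', pow_zero, mul_one]
  have hinv : PowerSeries.C w * PowerSeries.C v = 1 := by rw [← map_mul, hwv, map_one]
  have h4 := (h1.mul h2).mul h3
  rw [e1, e2] at h4
  have e3 : PowerSeries.C (-w) * ((1 - PowerSeries.C v) * eulerPartial v (N + 1) *
      eulerPartial w N) = eulerPartial v (N + 1) * (eulerPartial w N * (1 - PowerSeries.C w)) := by
    rw [map_neg]
    linear_combination (eulerPartial v (N + 1) * eulerPartial w N) * hinv
  rwa [e3]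

theorem unitT_val (b : Rˣ) : (unitT b : LaurentPolynomial R) = AddMonoidAlgebra.single 1 ↑b⁻¹ := rfl

theorem unitT_inv_val (b : Rˣ) :
    (↑(unitT b)⁻¹ : LaurentPolynomial R) = AddMonoidAlgebra.single (-1) ↑b := rfl

theorem isShift_thetaSeries (b : Rˣ) :
    IsShift (thetaSeries (unitT b))
      (PowerSeries.C (-(↑(unitT b)⁻¹ : LaurentPolynomial R)) * thetaSeries (unitT b)) := by
  have hN := fun N => isShift_eulerPartial (↑b⁻¹ : R) (b : R) N (unitT_val b) (unitT_inv_val b)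
    (Units.inv_mul _)
  have hcongr : ∀ (N : ℕ) (f g : PowerSeries (LaurentPolynomial R)),
      (∀ j ≤ N, PowerSeries.coeff j f = PowerSeries.coeff j g) → ∀ k l : ℤ, k ≤ N →
        bicoeff f k l = bicoeff g k l := by
    intro N f g h k l hk
    unfold bicoeff
    split_ifs with h0
    · rw [h _ (by omega)]
    · rfl
  intro k l
  -- Coefficients of order `k` and `k - l` are compared, so the truncation has to be exact up to
  -- both.
  set N := (max k (k - l)).toNat
  rw [hcongr N _ _ (coeff_mul_congr (fun _ _ => rfl)
      (coeff_thetaSeries (unitT b) (N := N + 1) (M := N) (by omega) le_rfl)) k l (by omega),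
    hcongr N _ _ (coeff_thetaSeries (unitT b) (N := N) (M := N + 1) le_rfl (by omega)) (k - l) l (by omega)]
  exact hN N k l

/-- `h(X T) = c T ^ (-M) h(T)`. -/
def QuasiPeriodic (c : R) (M : ℕ) (h : PowerSeries (LaurentPolynomial R)) : Prop :=
  IsShift h (PowerSeries.C (AddMonoidAlgebra.single (-(M : ℤ)) c : LaurentPolynomial R) * h)

theorem quasiPeriodic_thetaSeries (b : Rˣ) : QuasiPeriodic (-(b : R)) 1 (thetaSeries (unitT b)) := by
  have := isShift_thetaSeries b
  rwa [show (-(↑(unitT b)⁻¹ : LaurentPolynomial R)) =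
    AddMonoidAlgebra.single (-((1 : ℕ) : ℤ)) (-(b : R)) from
      (AddMonoidAlgebra.single_neg _ _).symm] at this

theorem QuasiPeriodic.mul {c d : R} {M N : ℕ} {g h : PowerSeries (LaurentPolynomial R)}
    (hg : QuasiPeriodic c M g) (hh : QuasiPeriodic d N h) :
    QuasiPeriodic (c * d) (M + N) (g * h) := by
  have := IsShift.mul hg hh
  rw [mul_mul_mul_comm, ← map_mul, AddMonoidAlgebra.single_mul_single] at this
  rwa [QuasiPeriodic, Nat.cast_add, neg_add]

theorem QuasiPeriodic.const_mul {c : R} {M : ℕ} {h : PowerSeries (LaurentPolynomial R)}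
    (hh : QuasiPeriodic c M h) (f : PowerSeries R) :
    QuasiPeriodic c M (f.map LaurentPolynomial.C * h) := by
  have := IsShift.mul (isShift_const f) hh
  rwa [mul_left_comm] at this

theorem QuasiPeriodic.sub {c : R} {M : ℕ} {g h : PowerSeries (LaurentPolynomial R)}
    (hg : QuasiPeriodic c M g) (hh : QuasiPeriodic c M h) : QuasiPeriodic c M (g - h) := by
  have := IsShift.sub hg hh
  rwa [← mul_sub] at this

theorem quasiPeriodic_zero (c : R) (M : ℕ) : QuasiPeriodic c M 0 := by
  intro k l
  simp [bicoeff]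

theorem QuasiPeriodic.add {c : R} {M : ℕ} {g h : PowerSeries (LaurentPolynomial R)}
    (hg : QuasiPeriodic c M g) (hh : QuasiPeriodic c M h) : QuasiPeriodic c M (g + h) := by
  simpa using hg.sub ((quasiPeriodic_zero c M).sub hh)

theorem quasiPeriodic_sum {ι : Type*} {c : R} {M : ℕ} (s : Finset ι)
    (g : ι → PowerSeries (LaurentPolynomial R)) (h : ∀ i ∈ s, QuasiPeriodic c M (g i)) :
    QuasiPeriodic c M (∑ i ∈ s, g i) := by
  classical
  induction s using Finset.induction_on with
  | empty => simpa using quasiPeriodic_zero c M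
  | insert i s hi ih =>
    rw [Finset.sum_insert hi]
    exact (h i (Finset.mem_insert_self _ _)).add
      (ih fun j hj => h j (Finset.mem_insert_of_mem hj))

theorem quasiPeriodic_prod_thetaSeries {ι : Type*} (s : Finset ι) (b : ι → Rˣ) :
    QuasiPeriodic (∏ i ∈ s, (-(b i : R))) s.card (∏ i ∈ s, thetaSeries (unitT (b i))) := by
  classical
  induction s using Finset.induction_on with
  | empty =>
    have := isShift_one (R := R)
    simpa [QuasiPeriodic] using this
  | insert i s hi ih =>
    rw [Finset.prod_insert hi, Finset.prod_insert hi, Finset.card_insert_of_notMem hi, add_comm]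
    exact (quasiPeriodic_thetaSeries (b i)).mul ih

/-- This recurrence relates coefficients of different orders in `X`; it confines the lowest nonzero
coefficient to the powers `T ^ 0, …, T ^ M`. -/
theorem QuasiPeriodic.bicoeff_eq {c : R} {M : ℕ} {h : PowerSeries (LaurentPolynomial R)}
    (hh : QuasiPeriodic c M h) (k l : ℤ) : bicoeff h (k - l) l = c * bicoeff h k (l + M) := by
  rw [← hh k l]
  unfold bicoeff
  split_ifs
  · rw [PowerSeries.coeff_C_mul, AddMonoidAlgebra.coeff_single_mul_eq_mul_coeff (l + M)]
    intro m _
    omega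
  · simp

/-- Evaluation of the coefficients of a power series at `T = z`. -/
noncomputable def evalT (z : Rˣ) : PowerSeries (LaurentPolynomial R) →+* PowerSeries R :=
  PowerSeries.map (LaurentPolynomial.eval₂ (RingHom.id R) z)

theorem evalT_thetaSeries (z b : Rˣ) : evalT z (thetaSeries (unitT b)) = thetaSeries (z / b) := by
  rw [evalT, map_thetaSeries]
  congr 1
  ext
  have : (unitT b : LaurentPolynomial R) = LaurentPolynomial.C (↑b⁻¹ : R) * LaurentPolynomial.T 1 :=
    LaurentPolynomial.single_eq_C_mul_T _ _
  change LaurentPolynomial.eval₂ (RingHom.id R) z (unitT b : LaurentPolynomial R) = _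
  rw [this, LaurentPolynomial.eval₂_C_mul_T]
  simp [div_eq_mul_inv, mul_comm]

theorem evalT_const (z : Rˣ) (f : PowerSeries R) : evalT z (f.map LaurentPolynomial.C) = f := by
  ext k
  simp [evalT]

end FormalTheta

/-! ### Theta interpolation and partial fractions -/

section FormalTheta

variable {A : Type*} [Field A] {ι : Type*}

/-- Such an `f` is a polynomial of degree at most `M = S.card` with `M` known roots, so it equals
its top coefficient times `∏ (T - a i)`. Comparing constant terms, the top coefficient is killed by
`c - ∏ (-a i) ≠ 0`. -/
theorem laurent_eq_zero_of_eval {c : A} (S : Finset ι) (a : ι → Aˣ) (ha : Set.InjOn a S)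
    (f : LaurentPolynomial A) (hf : ∀ l : ℤ, f.coeff l ≠ 0 → 0 ≤ l ∧ l ≤ S.card)
    (h0 : f.coeff 0 = c * f.coeff S.card) (hc : ∏ i ∈ S, (-(a i : A)) ≠ c)
    (hev : ∀ i ∈ S, LaurentPolynomial.eval₂ (RingHom.id A) (a i) f = 0) : f = 0 := by
  classical
  set M := S.card
  set P : Polynomial A := ∑ l ∈ Finset.range (M + 1), Polynomial.monomial l (f.coeff (l : ℤ))
    with hP
  have hcoeff : ∀ l : ℕ, P.coeff l = if l ≤ M then f.coeff l else 0 := by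
    intro l
    simp [hP, Polynomial.coeff_monomial]
  have hPf : Polynomial.toLaurent P = f := by
    ext l
    rw [hP, map_sum, AddMonoidAlgebra.coeff_sum, Finsupp.finsetSum_apply]
    simp only [Polynomial.toLaurent_C_mul_T, ← LaurentPolynomial.single_eq_C_mul_T,
      AddMonoidAlgebra.coeff_single]
    by_cases hl : f.coeff l = 0
    · rw [hl]
      refine Finset.sum_eq_zero fun m _ => ?_
      by_cases h : (m : ℤ) = l
      · rw [h, hl]; simp
      · rw [Finsupp.single_eq_of_ne (Ne.symm h)]
    · obtain ⟨h1, h2⟩ := hf l hl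
      lift l to ℕ using h1
      rw [Finset.sum_eq_single l]
      · simp
      · intro m _ hm
        rw [Finsupp.single_eq_of_ne]
        exact fun h => hm (by exact_mod_cast h.symm)
      · intro h; simp at h; omega
  have hroots : ∀ i ∈ S, P.eval (a i : A) = 0 := by
    intro i hi
    have := hev i hi
    rwa [← hPf, LaurentPolynomial.eval₂_toLaurent] at this
  set D : Polynomial A := ∏ i ∈ S, (Polynomial.X - Polynomial.C (a i : A)) with hD
  have hDdeg : D.natDegree = M := Polynomial.natDegree_finsetProd_X_sub_C_eq_card S _
  have hDmonic : D.Monic := Polynomial.monic_prod_of_monic _ _ fun i _ => Polynomial.monic_X_sub_C _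
  have hQ : P - Polynomial.C (f.coeff M) * D = 0 := by
    refine Polynomial.eq_zero_of_degree_lt_of_eval_index_eq_zero S
      (v := fun i => (a i : A)) (fun i hi j hj h => ha hi hj (Units.ext h)) ?_ ?_
    · rw [Polynomial.degree_lt_iff_coeff_zero]
      intro m hm
      rw [Polynomial.coeff_sub, Polynomial.coeff_C_mul, hcoeff]
      rcases hm.eq_or_lt with rfl | hm
      · have : D.coeff M = 1 := by rw [← hDdeg]; exact hDmonic
        rw [this]; simp [M]
      · rw [if_neg (by omega), Polynomial.coeff_eq_zero_of_natDegree_lt (by omega)]; simp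
    · intro i hi
      rw [Polynomial.eval_sub, hroots i hi, Polynomial.eval_mul, hD, Polynomial.eval_prod,
        Finset.prod_eq_zero hi (by simp)]
      simp
  have h00 := congrArg (Polynomial.eval 0) hQ
  rw [Polynomial.eval_sub, Polynomial.eval_mul, hD, Polynomial.eval_prod,
    ← Polynomial.coeff_zero_eq_eval_zero, hcoeff] at h00
  simp only [zero_le, if_true, Nat.cast_zero, h0, Polynomial.eval_C, Polynomial.eval_sub,
    Polynomial.eval_X, zero_sub, Polynomial.eval_zero] at h00
  have hM : f.coeff M = 0 := by
    have : (c - ∏ i ∈ S, (-(a i : A))) * f.coeff M = 0 := by linear_combination h00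
    exact (mul_eq_zero.1 this).resolve_left (sub_ne_zero.2 hc.symm)
  rw [hM, map_zero, zero_mul, sub_zero] at hQ
  rw [← hPf, hQ, map_zero]

/-- Formal counterpart of the fact that the zeros of a theta function of degree `M` have a
prescribed product. By induction on the order `k` in `X`: once the lower coefficients vanish, the
recurrence bounds the Laurent support of the `k`-th one by `[0, M]` and ties its two end
coefficients by the factor `c`. -/
theorem QuasiPeriodic.eq_zero {c : A} {h : PowerSeries (LaurentPolynomial A)} (S : Finset ι)
    (a : ι → Aˣ) (ha : Set.InjOn a S) (hh : QuasiPeriodic c S.card h) (hS : S.Nonempty)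
    (hc0 : c ≠ 0)    (hc : ∏ i ∈ S, (-(a i : A)) ≠ c) (hev : ∀ i ∈ S, evalT (a i) h = 0) : h = 0 := by
  ext1 k
  induction k using Nat.strong_induction_on with
  | _ k ih =>
    have hlow : ∀ k' : ℤ, k' < k → ∀ l, bicoeff h k' l = 0 := by
      intro k' hk' l
      rcases lt_or_ge k' 0 with h0 | h0
      · exact bicoeff_of_neg _ h0 _
      · lift k' to ℕ using h0
        rw [bicoeff_natCast, ih k' (by exact_mod_cast hk')]; simp
    rw [map_zero]
    have hM : 0 < S.card := hS.card_pos
    refine laurent_eq_zero_of_eval (c := c) S a ha _ ?_ ?_ hc ?_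
    · intro l hl
      rw [← bicoeff_natCast] at hl
      constructor
      · by_contra hneg
        apply hl
        have := hh.bicoeff_eq (k + l) l
        rw [add_sub_cancel_right, hlow (k + l) (by omega), mul_zero] at this
        exact this
      · by_contra hneg
        apply hl
        have := hh.bicoeff_eq k (l - S.card)
        rw [sub_add_cancel, hlow _ (by omega)] at this
        exact (mul_eq_zero.1 this.symm).resolve_left hc0
    · have := hh.bicoeff_eq k 0
      rwa [sub_zero, zero_add, bicoeff_natCast, bicoeff_natCast] at this
    · intro i hi
      have := congrArg (PowerSeries.coeff k) (hev i hi)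
      simpa [evalT] using this

/-- Lagrange interpolation in the variable `z` at the nodes `a i`. The parameter `a i / Q` gives
every summand the multiplier of the left side, since `(a i / Q) ∏_{j ≠ i} a j = ∏ b j`. Both sides
agree at the nodes because `θ(1) = 0`, and `Q ≠ 1` is the condition under which the nodes determine
the function. -/
theorem theta_interpolation [DecidableEq ι] (S : Finset ι) (hS : S.Nonempty) (a b : ι → Aˣ)
    (ha : Set.InjOn a S) (Q z : Aˣ) (hQ : Q * ∏ i ∈ S, b i = ∏ i ∈ S, a i) (hQ1 : Q ≠ 1) :
    thetaSeries Q * ∏ j ∈ S, thetaSeries (z / b j) =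
      ∑ i ∈ S, ((∏ j ∈ S, thetaSeries (a i / b j)) * (∏ j ∈ S.erase i, thetaSeries (a i / a j))⁻¹) *
        (thetaSeries (z / (a i / Q)) * ∏ j ∈ S.erase i, thetaSeries (z / a j)) := by
  set c : A := ∏ i ∈ S, (-(b i : A)) with hc
  have hQ' : (Q : A) * c = ∏ i ∈ S, (-(a i : A)) := by
    have := congrArg (Units.val) hQ
    simp only [Units.val_mul, Units.coe_prod] at this
    rw [hc, Finset.prod_neg, Finset.prod_neg, mul_left_comm, this]
  have hc0 : c ≠ 0 := Finset.prod_ne_zero_iff.2 fun i _ => neg_ne_zero.2 (b i).ne_zero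
  set w : ι → PowerSeries A := fun i =>
    (∏ j ∈ S, thetaSeries (a i / b j)) * (∏ j ∈ S.erase i, thetaSeries (a i / a j))⁻¹ with hw
  set h : PowerSeries (LaurentPolynomial A) :=
    (thetaSeries Q).map LaurentPolynomial.C * ∏ j ∈ S, thetaSeries (unitT (b j)) -
      ∑ i ∈ S, (w i).map LaurentPolynomial.C *
        (thetaSeries (unitT (a i / Q)) * ∏ j ∈ S.erase i, thetaSeries (unitT (a j))) with hh
  have hev : ∀ z : Aˣ, evalT z h = thetaSeries Q * ∏ j ∈ S, thetaSeries (z / b j) -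
      ∑ i ∈ S, w i *
        (thetaSeries (z / (a i / Q)) * ∏ j ∈ S.erase i, thetaSeries (z / a j)) := by
    intro z
    simp only [hh, map_sub, map_mul, map_sum, map_prod, evalT_const, evalT_thetaSeries]
  have hqp : QuasiPeriodic c S.card h := by
    refine ((quasiPeriodic_prod_thetaSeries S b).const_mul _).sub
      (quasiPeriodic_sum _ _ fun i hi => QuasiPeriodic.const_mul ?_ _)
    have := (quasiPeriodic_thetaSeries (a i / Q)).mul
      (quasiPeriodic_prod_thetaSeries (S.erase i) a)
    rw [Finset.card_erase_of_mem hi, add_tsub_cancel_of_le (Finset.one_le_card.2 hS)] at this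
    convert this using 1
    have h2 := Finset.mul_prod_erase S (fun i => -(a i : A)) hi
    rw [← hQ'] at h2
    rw [Units.val_div_eq_div_val]
    field_simp
    linear_combination -h2
  have hzero : h = 0 := by
    refine hqp.eq_zero S a ha hS hc0 ?_ ?_
    · rw [← hQ']
      intro h1
      apply hQ1
      ext
      have : ((Q : A) - 1) * c = 0 := by linear_combination h1
      simpa using sub_eq_zero.1 ((mul_eq_zero.1 this).resolve_right hc0)
    · intro i hi
      rw [hev, Finset.sum_eq_single i, hw]
      · simp only
        have hne : PowerSeries.constantCoeff (∏ j ∈ S.erase i, thetaSeries (a i / a j)) ≠ 0 := by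
          rw [map_prod]
          refine Finset.prod_ne_zero_iff.2 fun j hj => ?_
          rw [constantCoeff_thetaSeries, sub_ne_zero]
          intro h1
          have h2 : a i = a j := by
            rw [← div_eq_one]; ext; exact h1.symm
          exact (Finset.mem_erase.1 hj).1 (ha hi (Finset.mem_erase.1 hj).2 h2).symm
        rw [show a i / (a i / Q) = Q by simp]
        linear_combination (-(thetaSeries Q * ∏ j ∈ S, thetaSeries (a i / b j))) *
          PowerSeries.inv_mul_cancel _ hne
      · intro j hj hji
        rw [Finset.prod_eq_zero (i := i) (s := S.erase j)
          (Finset.mem_erase.2 ⟨Ne.symm hji, hi⟩) (by rw [div_self', thetaSeries_one]), mul_zero,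
          mul_zero]
      · exact fun h => absurd hi h
  have := hev z
  rw [hzero, map_zero] at this
  exact sub_eq_zero.1 this.symm

section FieldValued

variable {F : Type*} [Field F] (φ : PowerSeries A →+* F)

/-- The theta function with values in a field containing `A⟦X⟧`. -/
noncomputable def thetaVal (u : Aˣ) : F := φ (thetaSeries u)

theorem thetaVal_inv (u : Aˣ) :
    thetaVal φ u⁻¹ = -(φ (PowerSeries.C (u : A)))⁻¹ * thetaVal φ u := by
  rw [thetaVal, thetaSeries_inv, map_neg, map_mul, neg_mul]
  congr 2
  refine eq_inv_of_mul_eq_one_left ?_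
  rw [← map_mul, ← map_mul, Units.inv_mul, map_one, map_one]

variable {φ}

theorem thetaVal_ne_zero (hφ : Function.Injective φ) {u : Aˣ} (hu : u ≠ 1) :
    thetaVal φ u ≠ 0 := by
  intro h
  have h1 : thetaSeries u = 0 := hφ (by rw [map_zero]; exact h)
  have h2 := constantCoeff_thetaSeries u
  rw [h1, map_zero] at h2
  apply hu
  ext
  simpa using (sub_eq_zero.1 h2.symm).symm

/-- One index `m` with `a m ≠ b m` is split off, and `theta_interpolation` is applied on the rest
with `Q = b m / a m` and `z = a m`. The left side of the interpolation becomes the term of index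
`m`, up to sign and a common factor; inversion of theta arguments accounts for the monomials. -/
theorem sum_partial_fractions_thetaVal [DecidableEq ι] (hφ : Function.Injective φ) (S : Finset ι)
    (a b : ι → Aˣ) (ha : Set.InjOn a S) (hab : ∏ i ∈ S, a i = ∏ i ∈ S, b i)
    (hne : ∃ i ∈ S, a i ≠ b i) :
    ∑ i ∈ S, (∏ j ∈ S, thetaVal φ (a i / b j)) / ∏ j ∈ S.erase i, thetaVal φ (a i / a j) = 0 := by
  obtain ⟨m, hm, hmne⟩ := hne
  set U := S.erase m with hU
  have hSU : S = insert m U := (Finset.insert_erase hm).symm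
  have hmU : m ∉ U := Finset.notMem_erase _ _
  have hUne : U.Nonempty := by
    by_contra hempty
    rw [Finset.not_nonempty_iff_eq_empty] at hempty
    rw [hSU, hempty] at hab
    simp at hab
    exact hmne hab
  have hprod : b m / a m * ∏ i ∈ U, b i = ∏ i ∈ U, a i := by
    rw [hSU, Finset.prod_insert hmU, Finset.prod_insert hmU] at hab
    rw [div_mul_eq_mul_div, div_eq_iff_eq_mul, ← hab, mul_comm]
  have hint := theta_interpolation U hUne a b
    (ha.mono (by rw [hSU]; exact fun x hx => Finset.mem_insert_of_mem hx)) (b m / a m) (a m) hprod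
    (by rw [Ne, div_eq_one]; exact hmne.symm)
  have hthne : ∀ i ∈ S, ∀ j ∈ S, i ≠ j → thetaVal φ (a i / a j) ≠ 0 := by
    intro i hi j hj hij
    exact thetaVal_ne_zero hφ (by rw [Ne, div_eq_one]; exact fun h => hij (ha hi hj h))
  have hUS : ∀ i ∈ U, i ∈ S := fun i hi => by rw [hSU]; exact Finset.mem_insert_of_mem hi
  have hint' := congrArg φ hint
  simp only [map_mul, map_sum, map_prod] at hint'
  have hinv : ∀ i ∈ U, φ (∏ j ∈ U.erase i, thetaSeries (a i / a j))⁻¹ =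
      (∏ j ∈ U.erase i, thetaVal φ (a i / a j))⁻¹ := by
    intro i hi
    refine eq_inv_of_mul_eq_one_left ?_
    rw [show (∏ j ∈ U.erase i, thetaVal φ (a i / a j)) =
      φ (∏ j ∈ U.erase i, thetaSeries (a i / a j)) by rw [map_prod]; rfl, ← map_mul,
      PowerSeries.inv_mul_cancel, map_one]
    intro h0
    rw [map_prod, Finset.prod_eq_zero_iff] at h0
    obtain ⟨j, hj, h0⟩ := h0
    rw [constantCoeff_thetaSeries, sub_eq_zero] at h0
    refine (Finset.mem_erase.1 hj).1 (ha (hUS i hi) (hUS j (Finset.mem_erase.1 hj).2) ?_).symm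
    rw [← div_eq_one]; ext; exact h0.symm
  set W := ∏ j ∈ U, thetaVal φ (a m / a j) with hW
  have hWne : W ≠ 0 := Finset.prod_ne_zero_iff.2 fun j hj =>
    hthne m hm j (hUS j hj) fun h => hmU (h ▸ hj)
  set κ : Aˣ → F := fun u => φ (PowerSeries.C (u : A)) with hκ
  have hκmul : ∀ u v, κ (u / v) * κ v = κ u := by
    intro u v
    simp only [hκ]
    rw [← map_mul, ← map_mul, ← Units.val_mul, div_mul_cancel]
  have hκne : ∀ u, κ u ≠ 0 := by
    intro u h
    have := hκmul 1 u
    rw [h, mul_zero] at this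
    simp [hκ] at this
  have hterm : ∀ i ∈ U, φ (∏ j ∈ U.erase i, thetaSeries (a i / a j))⁻¹ *
      (φ (thetaSeries (a m / (a i / (b m / a m)))) *
        ∏ j ∈ U.erase i, φ (thetaSeries (a m / a j))) =
      (κ (b m) / κ (a m)) * W * (thetaVal φ (a i / b m) /
        ∏ j ∈ S.erase i, thetaVal φ (a i / a j)) := by
    intro i hi
    have him : i ≠ m := fun h => hmU (h ▸ hi)
    rw [hinv i hi, hW, ← Finset.mul_prod_erase U _ hi,
      show S.erase i = insert m (U.erase i) by
        rw [hSU, Finset.erase_insert_of_ne him.symm],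
      Finset.prod_insert fun h => hmU (Finset.mem_of_mem_erase h)]
    have e1 : φ (thetaSeries (a m / (a i / (b m / a m)))) =
        -(κ (a i / b m))⁻¹ * thetaVal φ (a i / b m) := by
      rw [show a m / (a i / (b m / a m)) = (a i / b m)⁻¹ by
        rw [inv_div, div_div_eq_mul_div, mul_div_cancel]]
      exact thetaVal_inv φ _
    have e2 : thetaVal φ (a m / a i) = -(κ (a i / a m))⁻¹ * thetaVal φ (a i / a m) := by
      rw [← thetaVal_inv, inv_div]
    have n1 : (∏ j ∈ U.erase i, thetaVal φ (a i / a j)) ≠ 0 :=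
      Finset.prod_ne_zero_iff.2 fun j hj => hthne i (hUS i hi) j
        (hUS j (Finset.mem_of_mem_erase hj)) (Finset.ne_of_mem_erase hj).symm
    have n2 : thetaVal φ (a i / a m) ≠ 0 := hthne i (hUS i hi) m hm him
    have k1 := hκmul (a i) (b m)
    have k2 := hκmul (a i) (a m)
    have n3 := hκne (a i / b m)
    have n4 := hκne (a i / a m)
    have n5 := hκne (b m)
    have n6 := hκne (a m)
    rw [e1, e2, show (∏ j ∈ U.erase i, φ (thetaSeries (a m / a j))) =
      ∏ j ∈ U.erase i, thetaVal φ (a m / a j) from rfl]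
    field_simp
    rw [mul_comm] at k1 k2
    linear_combination (thetaVal φ (a i / b m) * ∏ j ∈ U.erase i, thetaVal φ (a m / a j)) *
      (k1 - k2)
  have hfirst : φ (thetaSeries (b m / a m)) = -(κ (b m) / κ (a m)) * thetaVal φ (a m / b m) := by
    have e := thetaVal_inv φ (a m / b m)
    rw [inv_div] at e
    have k := hκmul (a m) (b m)
    have n1 := hκne (a m)
    have n2 := hκne (a m / b m)
    change thetaVal φ (b m / a m) = _
    rw [e, show κ (b m) / κ (a m) = (κ (a m / b m))⁻¹ by rw [← k]; field_simp [hκne]]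
  have hsum : ∑ i ∈ U, (∏ j ∈ S, thetaVal φ (a i / b j)) / (∏ j ∈ S.erase i, thetaVal φ (a i / a j))
      = -((∏ j ∈ S, thetaVal φ (a m / b j)) / W) := by
    have hK : (κ (b m) / κ (a m)) * W ≠ 0 :=
      mul_ne_zero (div_ne_zero (hκne _) (hκne _)) hWne
    apply mul_left_cancel₀ hK
    rw [Finset.mul_sum]
    have e1 : (κ (b m) / κ (a m)) * W * -((∏ j ∈ S, thetaVal φ (a m / b j)) / W) =
        φ (thetaSeries (b m / a m)) * ∏ x ∈ U, φ (thetaSeries (a m / b x)) := by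
      rw [hfirst, hSU, Finset.prod_insert hmU,
        show (∏ x ∈ U, φ (thetaSeries (a m / b x))) = ∏ x ∈ U, thetaVal φ (a m / b x) from rfl]
      field_simp
    rw [e1, hint']
    refine Finset.sum_congr rfl fun i hi => ?_
    rw [mul_assoc _ (φ _) _, hterm i hi]
    conv_lhs => rw [hSU, Finset.prod_insert hmU, ← hSU]
    rw [show (∏ x ∈ U, φ (thetaSeries (a i / b x))) = ∏ x ∈ U, thetaVal φ (a i / b x) from rfl]
    ring
  conv_lhs => rw [hSU, Finset.sum_insert hmU, ← hSU]
  rw [hsum, ← hU, add_neg_cancel]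

/-- The partial fraction identity is used with twice as many points: nodes `x i` and `x i / q`,
zeros `x i / t` and `t x i / q`, whose products agree. The nodes `x i` produce the left sum and the
nodes `x i / q` the right one, with the opposite common factors `± θ(t) θ(q / t) / θ(q)`; these are
nonzero because `t ≠ 1` and `t ≠ q`. -/
theorem sum_prod_thetaVal_eq [DecidableEq ι] (hφ : Function.Injective φ) (K : Finset ι)
    (x : ι → Aˣ) (q t : Aˣ) (hq : q ≠ 1) (ht : t ≠ 1) (htq : t ≠ q)
    (hx : ∀ i ∈ K, ∀ j ∈ K, i ≠ j → x i ≠ x j ∧ x i ≠ x j / q) :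
    ∑ i ∈ K, ∏ j ∈ K.erase i, (thetaVal φ (t * (x i / x j)) * thetaVal φ (q / t * (x i / x j))) /
        (thetaVal φ (x i / x j) * thetaVal φ (q * (x i / x j))) =
      ∑ i ∈ K, ∏ j ∈ K.erase i,
        (thetaVal φ (t⁻¹ * (x i / x j)) * thetaVal φ (t / q * (x i / x j))) /
        (thetaVal φ (x i / x j) * thetaVal φ (q⁻¹ * (x i / x j))) := by
  classical
  rcases K.eq_empty_or_nonempty with rfl | ⟨i₀, hi₀⟩
  · simp
  set S : Finset (ι × Bool) := K ×ˢ Finset.univ with hS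
  let a : ι × Bool → Aˣ := fun i => if i.2 then x i.1 / q else x i.1
  let b : ι × Bool → Aˣ := fun i => if i.2 then t * x i.1 / q else x i.1 / t
  have ha : Set.InjOn a S := by
    rintro ⟨i, e⟩ hi ⟨j, f⟩ hj h
    simp only [hS, Finset.coe_product, Set.mem_prod, Finset.mem_coe] at hi hj
    by_cases hij : i = j
    · subst hij
      have hself : x i ≠ x i / q := fun h => hq (by
        rw [eq_div_iff_mul_eq'] at h; simpa using h)
      cases e <;> cases f
      · rfl
      · exact absurd (by simpa [a] using h) hself
      · exact absurd (by simpa [a] using h.symm) hself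
      · rfl
    · have h1 := hx i hi.1 j hj.1 hij
      have h2 := hx j hj.1 i hi.1 (Ne.symm hij)
      cases e <;> cases f <;> simp_all [a]
  have hab : ∏ i ∈ S, a i = ∏ i ∈ S, b i := by
    rw [hS, Finset.prod_product, Finset.prod_product]
    refine Finset.prod_congr rfl fun i _ => ?_
    simp only [Fintype.prod_bool, a, b, if_true, Bool.false_eq_true, if_false]
    rw [div_mul_div_comm, mul_comm t (x i), mul_assoc, mul_comm t (x i), ← mul_assoc,
      mul_div_mul_right_eq_div, div_mul_eq_mul_div]
  have key := sum_partial_fractions_thetaVal hφ S a b ha hab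
    ⟨(i₀, false), by simp [hS, hi₀], fun h => ht (by
      have h' : x i₀ = x i₀ / t := by simpa [a, b] using h
      rw [eq_div_iff_mul_eq'] at h'; simpa using h')⟩
  have herase : ∀ i ∈ K, ∀ e : Bool, ∀ g : ι × Bool → F,
      ∏ j ∈ S.erase (i, e), g j = g (i, !e) * ∏ j ∈ K.erase i, (g (j, false) * g (j, true)) := by
    intro i hi e g
    have : S.erase (i, e) = insert (i, !e) ((K.erase i) ×ˢ Finset.univ) := by
      ext ⟨j, f⟩
      simp only [hS, Finset.mem_erase, Finset.mem_product, Finset.mem_univ, and_true,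
        Finset.mem_insert, Prod.mk.injEq, ne_eq, not_and]
      by_cases hij : j = i
      · subst hij
        cases e <;> cases f <;> simp [hi]
      · simp [hij]
    rw [this, Finset.prod_insert (by simp), Finset.prod_product]
    simp only [Fintype.prod_bool]
    congr 1
    exact Finset.prod_congr rfl fun _ _ => mul_comm _ _
  have hfull : ∀ i ∈ K, ∀ g : ι × Bool → F,
      ∏ j ∈ S, g j = (g (i, false) * g (i, true)) *
        ∏ j ∈ K.erase i, (g (j, false) * g (j, true)) := by
    intro i hi g
    rw [Finset.mul_prod_erase K (fun j => g (j, false) * g (j, true)) hi, hS, Finset.prod_product]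
    exact Finset.prod_congr rfl fun j _ => by rw [Fintype.prod_bool, mul_comm]
  have hff : ∀ i j, a (i, false) / b (j, false) = t * (x i / x j) := by
    intro i j
    apply Units.ext
    simp only [a, b, if_true, Bool.false_eq_true, if_false, Units.val_mul,
      Units.val_div_eq_div_val, Units.val_inv_eq_inv_val]
    field_simp
  have hft : ∀ i j, a (i, false) / b (j, true) = q / t * (x i / x j) := by
    intro i j
    apply Units.ext
    simp only [a, b, if_true, Bool.false_eq_true, if_false, Units.val_mul,
      Units.val_div_eq_div_val, Units.val_inv_eq_inv_val]
    field_simp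
  have htf : ∀ i j, a (i, true) / b (j, false) = t / q * (x i / x j) := by
    intro i j
    apply Units.ext
    simp only [a, b, if_true, Bool.false_eq_true, if_false, Units.val_mul,
      Units.val_div_eq_div_val, Units.val_inv_eq_inv_val]
    field_simp
  have htt : ∀ i j, a (i, true) / b (j, true) = t⁻¹ * (x i / x j) := by
    intro i j
    apply Units.ext
    simp only [a, b, if_true, Bool.false_eq_true, if_false, Units.val_mul,
      Units.val_div_eq_div_val, Units.val_inv_eq_inv_val]
    field_simp
  have aff : ∀ i j, a (i, false) / a (j, false) = x i / x j := fun i j => rfl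
  have aft : ∀ i j, a (i, false) / a (j, true) = q * (x i / x j) := by
    intro i j
    apply Units.ext
    simp only [a, if_true, Bool.false_eq_true, if_false, Units.val_mul,
      Units.val_div_eq_div_val, Units.val_inv_eq_inv_val]
    field_simp
  have atf : ∀ i j, a (i, true) / a (j, false) = q⁻¹ * (x i / x j) := by
    intro i j
    apply Units.ext
    simp only [a, if_true, Bool.false_eq_true, if_false, Units.val_mul,
      Units.val_div_eq_div_val, Units.val_inv_eq_inv_val]
    field_simp
  have att : ∀ i j, a (i, true) / a (j, true) = x i / x j := by
    intro i j
    apply Units.ext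
    simp only [a, if_true, Bool.false_eq_true, if_false, Units.val_mul,
      Units.val_div_eq_div_val, Units.val_inv_eq_inv_val]
    field_simp
  rw [Finset.sum_product] at key
  simp only [Fintype.sum_bool] at key
  rw [Finset.sum_congr rfl fun i hi => by
    rw [herase i hi true, hfull i hi, herase i hi false, hfull i hi]] at key
  simp only [Bool.not_true, Bool.not_false, hff, hft, htf, htt, aff, aft, atf, att, div_self',
    mul_one, mul_div_mul_comm, ← Finset.prod_div_distrib] at key
  rw [Finset.sum_add_distrib, ← Finset.mul_sum, ← Finset.mul_sum] at key
  have e1 := thetaVal_inv φ t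
  have e2 := thetaVal_inv φ q
  have e3 := thetaVal_inv φ (q / t)
  rw [inv_div] at e3
  have hκ : φ (PowerSeries.C (↑(q / t) : A)) * φ (PowerSeries.C (t : A)) =
      φ (PowerSeries.C (q : A)) := by
    rw [← map_mul, ← map_mul, ← Units.val_mul, div_mul_cancel]
  have hκne : ∀ u : Aˣ, φ (PowerSeries.C (u : A)) ≠ 0 := fun u h => by
    have : φ (PowerSeries.C (u : A)) * φ (PowerSeries.C (↑u⁻¹ : A)) = 1 := by
      rw [← map_mul, ← map_mul, Units.mul_inv, map_one, map_one]
    rw [h, zero_mul] at this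
    exact zero_ne_one this
  have n1 := thetaVal_ne_zero hφ hq
  have n2 := thetaVal_ne_zero hφ ht
  have n3 := thetaVal_ne_zero hφ (u := q / t) (by rw [Ne, div_eq_one]; exact htq.symm)
  have hc : thetaVal φ (t / q) * thetaVal φ t⁻¹ / thetaVal φ q⁻¹ =
      -(thetaVal φ t * thetaVal φ (q / t) / thetaVal φ q) := by
    rw [e1, e2, e3, ← hκ]
    have m1 := hκne (q / t)
    have m2 := hκne t
    field_simp
  rw [hc, neg_mul, neg_add_eq_zero] at key
  have key' := mul_left_cancel₀ (div_ne_zero (mul_ne_zero n2 n3) n1) key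
  simp only [mul_div_mul_comm]
  rw [← key']
  exact Finset.sum_congr rfl fun i _ => Finset.prod_congr rfl fun j _ => mul_comm _ _

end FieldValued

end FormalTheta

/-! ### Cyclic arcs and the symmetric form of the coefficients -/

section Transfer

variable {n : ℕ}

/-- The monomial `∏_{k ∈ S} z_k`. -/
noncomputable def xprod (S : Finset (Fin n)) : AsympSeries n := ∏ k ∈ S, MvPowerSeries.X k

theorem xprod_mul_compl (S : Finset (Fin n)) : xprod S * xprod Sᶜ = nome n :=
  Finset.prod_mul_prod_compl S _

theorem xprod_ne_zero (S : Finset (Fin n)) : xprod S ≠ 0 :=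
  Finset.prod_ne_zero_iff.2 fun k _ h => by
    have := congrArg (MvPowerSeries.coeff (Finsupp.single k 1)) h
    simp at this

theorem nome_ne_zero : nome n ≠ 0 := xprod_ne_zero Finset.univ

theorem constantCoeff_xprod {S : Finset (Fin n)} (hS : S.Nonempty) :
    MvPowerSeries.constantCoeff (xprod S) = 0 := by
  obtain ⟨k, hk⟩ := hS
  rw [xprod, map_prod, Finset.prod_eq_zero hk (MvPowerSeries.constantCoeff_X k)]

/-- The variables whose product is `x_j / x_i`, or `p x_j / x_i` for `j < i`. -/
def cyc (i j : Fin n) : Finset (Fin n) :=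
  if i < j then Finset.Ioc i j else (Finset.Ioc j i)ᶜ

theorem mem_cyc {i j k : Fin n} :
    k ∈ cyc i j ↔ if i < j then i < k ∧ k ≤ j else ¬(j < k ∧ k ≤ i) := by
  unfold cyc; split_ifs <;> simp

theorem coeff_nome_pow_mul {β : Fin n →₀ ℕ} {m : Fin n} {N : ℕ} (h : β m < N)
    (f : AsympSeries n) : MvPowerSeries.coeff β (nome n ^ N * f) = 0 := by
  refine (MvPowerSeries.X_pow_dvd_iff (s := m)).1 ?_ β h
  exact (pow_dvd_pow_of_dvd (Finset.dvd_prod_of_mem _ (Finset.mem_univ m)) N).mul_right f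

theorem coeff_prod_nome_stable {β : Fin n →₀ ℕ} {m : Fin n} {N M : ℕ} (h : β m < N) (hM : N ≤ M)
    (a : AsympSeries n) :
    MvPowerSeries.coeff β (∏ i ∈ Finset.range M, (1 - nome n ^ i * a)) =
      MvPowerSeries.coeff β (∏ i ∈ Finset.range N, (1 - nome n ^ i * a)) := by
  induction M, hM using Nat.le_induction with
  | base => rfl
  | succ M hM ih =>
    rw [Finset.prod_range_succ, mul_sub, mul_one, map_sub, ih, mul_left_comm,
      coeff_nome_pow_mul (h.trans_le hM), sub_zero]

/-- The power `p ^ N` is divisible by `z_m ^ N`, so the degree in a single variable suffices to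
bound the truncation. With `m = 0` this is what an expansion by the degree in `z₀` requires. -/
theorem coeff_pochhammer {β : Fin n →₀ ℕ} {m : Fin n} {N : ℕ} (h : β m < N) (a : AsympSeries n) :
    MvPowerSeries.coeff β (pochhammer a) =
      MvPowerSeries.coeff β (∏ i ∈ Finset.range N, (1 - nome n ^ i * a)) := by
  change MvPowerSeries.coeff β (∏ i ∈ Finset.range (β.degree + 1), (1 - nome n ^ i * a)) = _
  have h' : β m < β.degree + 1 := Nat.lt_succ_of_le (Finsupp.le_degree m β)
  rcases le_total N (β.degree + 1) with hN | hN
  · exact coeff_prod_nome_stable h hN a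
  · exact (coeff_prod_nome_stable h' hN a).symm

theorem constantCoeff_pochhammer (a : AsympSeries n) (ha : MvPowerSeries.constantCoeff a = 0) :
    MvPowerSeries.constantCoeff (pochhammer a) = 1 := by
  rw [← MvPowerSeries.coeff_zero_eq_constantCoeff_apply]
  change MvPowerSeries.coeff 0 (∏ i ∈ Finset.range ((0 : Fin n →₀ ℕ).degree + 1), _) = _
  simp [ha]

/-- A coefficientwise compatible map commutes with the shifted factorial. -/
theorem map_pochhammer (σ : AsympSeries n →+* AsympSeries n) (w : (Fin n →₀ ℕ) → ℂ)
    (e : (Fin n →₀ ℕ) → (Fin n →₀ ℕ)) (hdeg : ∀ β, (e β).degree = β.degree)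
    (hσ : ∀ f β, MvPowerSeries.coeff β (σ f) = w β * MvPowerSeries.coeff (e β) f)
    (hnome : σ (nome n) = nome n) (a : AsympSeries n) :
    σ (pochhammer a) = pochhammer (σ a) := by
  ext β
  rw [hσ]
  change w β * MvPowerSeries.coeff (e β) (∏ i ∈ Finset.range ((e β).degree + 1), _) =
    MvPowerSeries.coeff β (∏ i ∈ Finset.range (β.degree + 1), _)
  rw [← hσ, hdeg, map_prod]
  simp only [map_sub, map_one, map_mul, map_pow, hnome]

/-- `θ(c x_i / x_j)` up to a monomial factor, for `i ≠ j`. -/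
noncomputable def thetaPair (c : ℂ) (i j : Fin n) : AsympSeries n :=
  pochhammer (MvPowerSeries.C c⁻¹ * xprod (cyc i j)) *
    pochhammer (MvPowerSeries.C c * xprod (cyc j i))

theorem thetaPair_inv (c : ℂ) (i j : Fin n) : thetaPair c⁻¹ i j = thetaPair c j i := by
  rw [thetaPair, thetaPair, inv_inv, mul_comm]

theorem theta_eq_thetaPair (c : ℂ) {i j : Fin n} (h : i < j) : theta c i j = thetaPair c j i := by
  rw [theta, thetaPair, mul_comm]
  simp only [cyc, if_pos h, if_neg h.asymm]
  rfl

theorem cyc_nonempty (i j : Fin n) : (cyc i j).Nonempty := by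
  refine ⟨j, ?_⟩
  rw [mem_cyc]
  split_ifs with h1
  · exact ⟨h1, le_rfl⟩
  · simp

theorem constantCoeff_thetaPair (c : ℂ) (i j : Fin n) :
    MvPowerSeries.constantCoeff (thetaPair c i j) = 1 := by
  rw [thetaPair, map_mul, constantCoeff_pochhammer, constantCoeff_pochhammer, mul_one]
  · rw [map_mul, constantCoeff_xprod (cyc_nonempty j i), mul_zero]
  · rw [map_mul, constantCoeff_xprod (cyc_nonempty i j), mul_zero]

/-- The factor of `opCoeff t I` for `i ∈ I` and `j ∉ I`. -/
noncomputable def pairCoeff (c d : ℂ) (i j : Fin n) : AsympSeries n :=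
  thetaPair c i j * (thetaPair d i j)⁻¹

/-- The parameters `t⁻¹` and `t` in the two products of the modified operator are those for which
both are instances of one factor depending on cyclic arcs only. This hidden symmetry is the source
of the theorem. -/
theorem opCoeff_eq (t : ℂ) (I : Finset (Fin n)) :
    opCoeff t I = ∏ i ∈ I, ∏ j ∈ Iᶜ, pairCoeff t 1 i j := by
  have h2 : (∏ i ∈ Iᶜ, ∏ j ∈ I with i < j, theta t i j * (theta 1 i j)⁻¹) =
      ∏ j ∈ I, ∏ i ∈ Iᶜ with ¬ j < i, pairCoeff t 1 j i := by
    simp only [Finset.prod_filter]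
    rw [Finset.prod_comm]
    refine Finset.prod_congr rfl fun j hj => Finset.prod_congr rfl fun i hi => ?_
    have hne : i ≠ j := fun h => Finset.mem_compl.1 hi (h ▸ hj)
    by_cases hij : i < j
    · rw [if_pos hij, if_pos hij.asymm, theta_eq_thetaPair _ hij, theta_eq_thetaPair _ hij]
      rfl
    · rw [if_neg hij, if_neg]
      exact not_not.2 (lt_of_le_of_ne (not_lt.1 hij) hne.symm)
  have h1 : (∏ i ∈ I, ∏ j ∈ Iᶜ with i < j, theta t⁻¹ i j * (theta 1 i j)⁻¹) =
      ∏ i ∈ I, ∏ j ∈ Iᶜ with i < j, pairCoeff t 1 i j := by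
    refine Finset.prod_congr rfl fun i _ => Finset.prod_congr rfl fun j hj => ?_
    have hij := (Finset.mem_filter.1 hj).2
    rw [theta_eq_thetaPair _ hij, theta_eq_thetaPair _ hij, thetaPair_inv, ← thetaPair_inv 1 i j,
      inv_one]
    rfl
  rw [opCoeff, h1, h2, ← Finset.prod_mul_distrib]
  exact Finset.prod_congr rfl fun i _ => Finset.prod_filter_mul_prod_filter_not _ _ _

variable [NeZero n]

theorem val_add_one_eq (k : Fin n) : (k + 1).val = if k.val + 1 = n then 0 else k.val + 1 := by
  have hn : 0 < n := Nat.pos_of_ne_zero (NeZero.ne n)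
  have hk := k.isLt
  rw [Fin.val_add, Fin.val_one']
  rw [Nat.add_mod_mod]
  split_ifs with h
  · rw [h, Nat.mod_self]
  · exact Nat.mod_eq_of_lt (by omega)

theorem add_one_mem_cyc_add_one {i j k : Fin n} (h : i ≠ j) :
    k + 1 ∈ cyc (i + 1) (j + 1) ↔ k ∈ cyc i j := by
  have h' : i.val ≠ j.val := fun e => h (Fin.ext e)
  have hi := i.isLt
  have hj := j.isLt
  have hk := k.isLt
  simp only [mem_cyc, Fin.lt_def, Fin.le_def, val_add_one_eq]
  split_ifs <;> omega

/-- The cyclic difference of the indicator of an arc gives the exponents of the `x_k`: the arc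
monomial is `x_j / x_i` up to a power of `p`, which shifts do not see. -/
theorem indicator_cyc_sub {i j : Fin n} (h : i ≠ j) (k : Fin n) :
    (if k ∈ cyc i j then (1 : ℤ) else 0) - (if k + 1 ∈ cyc i j then 1 else 0) =
      (if k = j then 1 else 0) - (if k = i then 1 else 0) := by
  have h' : i.val ≠ j.val := fun e => h (Fin.ext e)
  have hi := i.isLt
  have hj := j.isLt
  have hk := k.isLt
  simp only [mem_cyc, Fin.lt_def, Fin.le_def, val_add_one_eq, Fin.ext_iff]
  split_ifs <;> omega

end Transfer

/-! ### Expansion of the asymptotic series in powers of the nome -/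

section Expansion

variable {n : ℕ} [NeZero n]

/-- The part of `f` of degree `k` in `z₀`. -/
def slice (k : ℕ) (f : AsympSeries n) : AsympSeries n := fun β : Fin n →₀ ℕ =>
  if β 0 = k then MvPowerSeries.coeff β f else 0

theorem coeff_slice (k : ℕ) (f : AsympSeries n) (β : Fin n →₀ ℕ) :
    MvPowerSeries.coeff β (slice k f) = if β 0 = k then MvPowerSeries.coeff β f else 0 := rfl

theorem slice_mul (k : ℕ) (f g : AsympSeries n) :
    slice k (f * g) = ∑ x ∈ Finset.HasAntidiagonal.antidiagonal k, slice x.1 f * slice x.2 g := by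
  classical
  ext β
  rw [coeff_slice, map_sum]
  simp only [MvPowerSeries.coeff_mul, coeff_slice, ite_zero_mul_ite_zero]
  rw [Finset.sum_comm]
  split_ifs with h
  · refine Finset.sum_congr rfl fun y hy => ?_
    have hy' := Finset.HasAntidiagonal.mem_antidiagonal.1 hy
    rw [Finset.sum_eq_single (y.1 0, y.2 0)]
    · simp
    · intro x _ hx
      rw [if_neg]
      rintro ⟨h1, h2⟩
      exact hx (Prod.ext h1.symm h2.symm)
    · intro hx
      exfalso
      apply hx
      rw [Finset.HasAntidiagonal.mem_antidiagonal, ← h, ← hy', Finsupp.add_apply]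
  · symm
    refine Finset.sum_eq_zero fun y hy => Finset.sum_eq_zero fun x hx => ?_
    rw [if_neg]
    rintro ⟨h1, h2⟩
    apply h
    have hy' := Finset.HasAntidiagonal.mem_antidiagonal.1 hy
    have hx' := Finset.HasAntidiagonal.mem_antidiagonal.1 hx
    rw [← hy', Finsupp.add_apply, h1, h2, ← hx']

/-- The field of fractions of `AsympSeries n`. -/
abbrev AsympField (n : ℕ) : Type := FractionRing (AsympSeries n)

theorem algebraMap_nome_ne_zero :
    algebraMap (AsympSeries n) (AsympField n) (nome n) ≠ 0 := by
  rw [Ne, IsFractionRing.to_map_eq_zero_iff]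
  exact nome_ne_zero

/-- The expansion in powers of the nome `X`: `z₀` is replaced by `X / (z₁ ⋯ zₙ₋₁)`. -/
noncomputable def nomeExpansion (n : ℕ) [NeZero n] :
    AsympSeries n →+* PowerSeries (AsympField n) where
  toFun f := PowerSeries.mk fun k =>
    algebraMap (AsympSeries n) (AsympField n) (slice k f) /
      algebraMap (AsympSeries n) (AsympField n) (nome n) ^ k
  map_one' := by
    classical
    ext k
    rw [PowerSeries.coeff_mk, PowerSeries.coeff_one]
    have : slice k (1 : AsympSeries n) = if k = 0 then 1 else 0 := by
      ext β
      rw [coeff_slice, MvPowerSeries.coeff_one]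
      by_cases hβ : β = 0
      · subst hβ
        by_cases hk : k = 0
        · simp [hk]
        · simp [hk, Ne.symm hk]
      · by_cases hk : k = 0
        · simp [hk, hβ, MvPowerSeries.coeff_one]
        · simp [hk, hβ]
    rw [this]
    split_ifs with hk
    · simp [hk]
    · simp
  map_zero' := by
    ext k
    have : slice k (0 : AsympSeries n) = 0 := by
      ext β; simp [coeff_slice]
    simp [this]
  map_add' f g := by
    ext k
    have : slice k (f + g) = slice k f + slice k g := by
      ext β; rw [map_add]; simp only [coeff_slice]; split_ifs <;> simp
    simp [this, add_div]
  map_mul' f g := by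
    ext k
    rw [PowerSeries.coeff_mk, PowerSeries.coeff_mul, slice_mul, map_sum, Finset.sum_div]
    refine Finset.sum_congr rfl fun x hx => ?_
    rw [PowerSeries.coeff_mk, PowerSeries.coeff_mk, map_mul,
      ← Finset.HasAntidiagonal.mem_antidiagonal.1 hx, pow_add, mul_div_mul_comm]

theorem coeff_nomeExpansion (f : AsympSeries n) (k : ℕ) :
    PowerSeries.coeff k (nomeExpansion n f) =
      algebraMap (AsympSeries n) (AsympField n) (slice k f) /
        algebraMap (AsympSeries n) (AsympField n) (nome n) ^ k :=
  PowerSeries.coeff_mk k fun k => algebraMap (AsympSeries n) (AsympField n) (slice k f) /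
      algebraMap (AsympSeries n) (AsympField n) (nome n) ^ k

theorem nomeExpansion_injective : Function.Injective (nomeExpansion n) := by
  rw [injective_iff_map_eq_zero]
  intro f hf
  ext β
  have h := congrArg (PowerSeries.coeff (β 0)) hf
  rw [coeff_nomeExpansion, (PowerSeries.coeff (R := AsympField n) _).map_zero, div_eq_zero_iff,
    or_iff_left (pow_ne_zero _ algebraMap_nome_ne_zero), IsFractionRing.to_map_eq_zero_iff] at h
  have h' := congrArg (MvPowerSeries.coeff β) h
  rwa [coeff_slice, if_pos rfl] at h'

theorem nomeExpansion_of_slice {f : AsympSeries n} {k : ℕ}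
    (hf : ∀ β, MvPowerSeries.coeff β f ≠ 0 → β 0 = k) :
    nomeExpansion n f = PowerSeries.C (algebraMap (AsympSeries n) (AsympField n) f /
        algebraMap (AsympSeries n) (AsympField n) (nome n) ^ k) * PowerSeries.X ^ k := by
  ext j
  rw [coeff_nomeExpansion, PowerSeries.coeff_C_mul, PowerSeries.coeff_X_pow]
  have : slice j f = if j = k then f else 0 := by
    ext β
    rw [coeff_slice]
    by_cases hβ : MvPowerSeries.coeff β f = 0
    · split_ifs <;> simp [hβ]
    · rw [hf β hβ]
      by_cases hj : k = j
      · rw [if_pos hj, if_pos hj.symm]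
      · rw [if_neg hj, if_neg (Ne.symm hj), map_zero]
  rw [this]
  split_ifs with h
  · rw [h, mul_one]
  · simp

theorem xprod_eq_monomial (S : Finset (Fin n)) :
    xprod S = MvPowerSeries.monomial (∑ k ∈ S, Finsupp.single k 1) (1 : ℂ) := by
  simp only [xprod, MvPowerSeries.X_def, MvPowerSeries.prod_monomial, Finset.prod_const_one]

theorem nomeExpansion_C_mul_xprod (c : ℂ) (S : Finset (Fin n)) :
    nomeExpansion n (MvPowerSeries.C c * xprod S) =
      PowerSeries.C (algebraMap (AsympSeries n) (AsympField n) (MvPowerSeries.C c * xprod S) /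
        algebraMap (AsympSeries n) (AsympField n) (nome n) ^ (if (0 : Fin n) ∈ S then 1 else 0)) *
          PowerSeries.X ^ (if (0 : Fin n) ∈ S then 1 else 0) := by
  classical
  refine nomeExpansion_of_slice fun β hβ => ?_
  rw [MvPowerSeries.coeff_C_mul, xprod_eq_monomial, MvPowerSeries.coeff_monomial] at hβ
  have hβ' : β = ∑ k ∈ S, Finsupp.single k 1 := by
    by_contra h
    simp [h] at hβ
  rw [hβ', Finsupp.finsetSum_apply]
  simp [Finsupp.single_apply]

theorem algebraMap_xprod_ne_zero (S : Finset (Fin n)) :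
    algebraMap (AsympSeries n) (AsympField n) (xprod S) ≠ 0 := by
  rw [Ne, IsFractionRing.to_map_eq_zero_iff]
  exact xprod_ne_zero S

/-- The coordinate `x_i` (with `x_1 = 1`) in the field of fractions. -/
noncomputable def coord (i : Fin n) : (AsympField n)ˣ :=
  Units.mk0 (algebraMap (AsympSeries n) (AsympField n) (xprod (Finset.Ioc 0 i)))
    (algebraMap_xprod_ne_zero _)

/-- Nonzero constants as units of the field of fractions. -/
noncomputable def constUnit (n : ℕ) : ℂˣ →* (AsympField n)ˣ :=
  Units.map ((algebraMap (AsympSeries n) (AsympField n)).comp MvPowerSeries.C).toMonoidHom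

theorem constUnit_val (c : ℂˣ) : (constUnit n c : AsympField n) =
    algebraMap (AsympSeries n) (AsympField n) (MvPowerSeries.C (c : ℂ)) := rfl

theorem coord_mul {i j : Fin n} (h : i ≤ j) :
    (coord j : AsympField n) =
      coord i * algebraMap (AsympSeries n) (AsympField n) (xprod (Finset.Ioc i j)) := by
  simp only [coord, Units.val_mk0, xprod]
  rw [← map_mul, ← Finset.prod_union]
  · rw [Finset.Ioc_union_Ioc_eq_Ioc (Fin.zero_le i) h]
  · rw [Finset.disjoint_left]
    intro k hk hk'
    exact absurd (Finset.mem_Ioc.1 hk).2 (not_le.2 (Finset.mem_Ioc.1 hk').1)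

/-- An arc contains `z₀` exactly when it wraps around, that is when `j < i`; then its monomial is `p
x_j / x_i` and contributes one factor `X`. -/
theorem nomeExpansion_cyc (c : ℂˣ) {i j : Fin n} (h : i ≠ j) :
    nomeExpansion n (MvPowerSeries.C (c : ℂ) * xprod (cyc i j)) =
      PowerSeries.C (↑(constUnit n c * (coord j / coord i)) : AsympField n) *
        PowerSeries.X ^ (if i < j then 0 else 1) := by
  rw [nomeExpansion_C_mul_xprod, map_mul, Units.val_mul, Units.val_div_eq_div_val, constUnit_val]
  have hi := (coord i).ne_zero
  have hj := (coord j).ne_zero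
  by_cases hij : i < j
  · have h0 : (0 : Fin n) ∉ cyc i j := by
      rw [mem_cyc, if_pos hij]
      exact fun h => absurd h.1 (not_lt.2 (Fin.zero_le _))
    rw [if_neg h0, if_pos hij, pow_zero, div_one, coord_mul hij.le, cyc, if_pos hij,
      mul_div_cancel_left₀ _ hi]
  · have hji : j < i := lt_of_le_of_ne (not_lt.1 hij) h.symm
    have h0 : (0 : Fin n) ∈ cyc i j := by
      rw [mem_cyc, if_neg hij]
      exact fun h => absurd h.1 (not_lt.2 (Fin.zero_le _))
    have hS := algebraMap_xprod_ne_zero (Finset.Ioc j i)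
    have hS' := algebraMap_xprod_ne_zero (Finset.Ioc j i)ᶜ
    rw [if_pos h0, if_neg hij, pow_one, coord_mul hji.le, cyc, if_neg hij,
      ← xprod_mul_compl (Finset.Ioc j i), map_mul]
    congr 2
    field_simp

theorem coeff_nomeExpansion_congr {f g : AsympSeries n} {k : ℕ}
    (h : ∀ β : Fin n →₀ ℕ, β 0 = k → MvPowerSeries.coeff β f = MvPowerSeries.coeff β g) :
    PowerSeries.coeff k (nomeExpansion n f) = PowerSeries.coeff k (nomeExpansion n g) := by
  have : slice k f = slice k g := by
    ext β
    rw [coeff_slice, coeff_slice]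
    split_ifs with hβ
    · exact h β hβ
    · rfl
  rw [coeff_nomeExpansion, coeff_nomeExpansion, this]

theorem nomeExpansion_nome : nomeExpansion n (nome n) = PowerSeries.X := by
  have h := nomeExpansion_C_mul_xprod 1 (Finset.univ : Finset (Fin n))
  rw [map_one, one_mul, if_pos (Finset.mem_univ _), pow_one, pow_one,
    show xprod (Finset.univ : Finset (Fin n)) = nome n from rfl,
    div_self algebraMap_nome_ne_zero, map_one, one_mul] at h
  exact h

theorem coeff_nomeExpansion_pochhammer (a : AsympSeries n) {k N : ℕ} (h : k < N) :
    PowerSeries.coeff k (nomeExpansion n (pochhammer a)) =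
      PowerSeries.coeff k (∏ i ∈ Finset.range N, (1 - PowerSeries.X ^ i * nomeExpansion n a)) := by
  rw [coeff_nomeExpansion_congr (g := ∏ i ∈ Finset.range N, (1 - nome n ^ i * a))
    fun β hβ => coeff_pochhammer (m := 0) (by omega) a, map_prod]
  simp only [map_sub, map_one, map_mul, map_pow, nomeExpansion_nome]

theorem nomeExpansion_pochhammer_of_C {a : AsympSeries n} {w : AsympField n}
    (ha : nomeExpansion n a = PowerSeries.C w) :
    nomeExpansion n (pochhammer a) = (1 - PowerSeries.C w) * eulerProd w := by
  ext k
  rw [coeff_nomeExpansion_pochhammer a (Nat.lt_succ_self (k + 1)).le, Finset.prod_range_succ',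
    pow_zero, one_mul, ha, mul_comm]
  refine coeff_mul_congr (k := k) (fun _ _ => rfl) (fun j hj => ?_) k le_rfl
  rw [coeff_eulerProd w (hj.trans k.le_succ), eulerPartial]
  simp only [mul_comm]

theorem nomeExpansion_pochhammer_of_C_mul_X {a : AsympSeries n} {w : AsympField n}
    (ha : nomeExpansion n a = PowerSeries.C w * PowerSeries.X) :
    nomeExpansion n (pochhammer a) = eulerProd w := by
  ext k
  rw [coeff_nomeExpansion_pochhammer a (Nat.lt_succ_self k), ha, coeff_eulerProd w k.le_succ,
    eulerPartial]
  simp only [pow_succ, mul_left_comm]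

/-- The unit `c x_i / x_j`. -/
noncomputable def ratioUnit (c : ℂˣ) (i j : Fin n) : (AsympField n)ˣ :=
  constUnit n c * (coord i / coord j)

theorem ratioUnit_inv (c : ℂˣ) (i j : Fin n) : (ratioUnit c i j)⁻¹ = ratioUnit c⁻¹ j i := by
  rw [ratioUnit, ratioUnit, mul_inv, inv_div, map_inv]

theorem nomeExpansion_thetaPair (c : ℂˣ) {i j : Fin n} (h : i ≠ j) :
    nomeExpansion n (thetaPair (c : ℂ) i j) =
      if i < j then thetaSeries (ratioUnit c i j)⁻¹ else thetaSeries (ratioUnit c i j) := by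
  rw [thetaPair, map_mul, ← Units.val_inv_eq_inv_val]
  have h1 := nomeExpansion_cyc c⁻¹ h
  have h2 := nomeExpansion_cyc c h.symm
  change _ = PowerSeries.C (↑(ratioUnit c⁻¹ j i) : AsympField n) * _ at h1
  change _ = PowerSeries.C (↑(ratioUnit c i j) : AsympField n) * _ at h2
  rw [← ratioUnit_inv] at h1
  split_ifs with hij
  · rw [if_pos hij, pow_zero, mul_one] at h1
    rw [if_neg hij.asymm, pow_one] at h2
    rw [nomeExpansion_pochhammer_of_C h1, nomeExpansion_pochhammer_of_C_mul_X h2, thetaSeries,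
      inv_inv]
  · have hji : j < i := lt_of_le_of_ne (not_lt.1 hij) h.symm
    rw [if_neg hij, pow_one] at h1
    rw [if_pos hji, pow_zero, mul_one] at h2
    rw [nomeExpansion_pochhammer_of_C h2, nomeExpansion_pochhammer_of_C_mul_X h1, thetaSeries]
    ring

/-- The ratio of two coordinates is a nonconstant monomial or its inverse, so it has no nonzero
constant value. This supplies the distinctness of the nodes in the theta identity. -/
theorem coord_ne_const_mul (c : ℂˣ) {i j : Fin n} (h : i ≠ j) :
    coord i ≠ constUnit n c * coord j := by
  have key : ∀ (c : ℂˣ) {i j : Fin n}, i < j → coord j ≠ constUnit n c * coord i := by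
    intro c i j hij heq
    have h1 := congrArg Units.val heq
    rw [coord_mul hij.le, Units.val_mul, mul_comm, constUnit_val] at h1
    have h2 := IsFractionRing.injective (AsympSeries n) (AsympField n)
      (mul_right_cancel₀ (coord i).ne_zero h1)
    have h3 := congrArg MvPowerSeries.constantCoeff h2
    rw [constantCoeff_xprod ⟨j, Finset.mem_Ioc.2 ⟨hij, le_rfl⟩⟩, MvPowerSeries.constantCoeff_C] at h3
    exact c.ne_zero h3.symm
  rcases lt_or_gt_of_ne h with hij | hij
  · intro heq
    refine key c⁻¹ hij ?_
    rw [heq, map_inv, inv_mul_cancel_left]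
  · exact key c hij

end Expansion

/-! ### The `q`-shifts and their action on the coefficients -/

section Shift

variable {n : ℕ} [NeZero n]

/-- The exponent of `x_i` in the monomial `z ^ β`. -/
def expo (β : Fin n →₀ ℕ) (i : Fin n) : ℤ := (β i : ℤ) - (β (i + 1) : ℤ)

theorem prod_zpow_eq {ι : Type*} {q : ℂ} (hq : q ≠ 0) (s : Finset ι) (f : ι → ℤ) :
    ∏ i ∈ s, q ^ f i = q ^ ∑ i ∈ s, f i := by
  classical
  induction s using Finset.induction_on with
  | empty => simp
  | insert i s hi ih => rw [Finset.prod_insert hi, Finset.sum_insert hi, zpow_add₀ hq, ih]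

/-- The shift `x_i ↦ q ^ (M i) x_i`. -/
noncomputable def shiftHom (q : ℂ) (M : Fin n → ℤ) : AsympSeries n →+* AsympSeries n :=
  MvPowerSeries.rescale fun k => q ^ (M k - M (k - 1))

/-- Cyclic summation by parts; it translates between scaling the `x_i` and scaling the `z_k`. -/
theorem sum_mul_sub_add_one (M N : Fin n → ℤ) :
    ∑ i, M i * (N i - N (i + 1)) = ∑ k, (M k - M (k - 1)) * N k := by
  simp only [mul_sub, sub_mul, Finset.sum_sub_distrib]
  congr 1
  rw [← Equiv.sum_comp (Equiv.addRight (1 : Fin n)) fun k => M (k - 1) * N k]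
  simp

variable {q : ℂ} (hq : q ≠ 0)
include hq

theorem coeff_shiftHom (M : Fin n → ℤ) (f : AsympSeries n) (β : Fin n →₀ ℕ) :
    MvPowerSeries.coeff β (shiftHom q M f) =
      q ^ (∑ i, M i * expo β i) * MvPowerSeries.coeff β f := by
  rw [shiftHom, MvPowerSeries.coeff_rescale, Finsupp.prod_fintype _ _ (by simp)]
  simp only [← zpow_natCast, ← zpow_mul]
  rw [prod_zpow_eq hq, ← sum_mul_sub_add_one M fun k => (β k : ℤ)]
  rfl

theorem shiftHom_shiftHom (M N : Fin n → ℤ) (f : AsympSeries n) :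
    shiftHom q M (shiftHom q N f) = shiftHom q (M + N) f := by
  ext β
  rw [coeff_shiftHom hq, coeff_shiftHom hq, coeff_shiftHom hq, ← mul_assoc, ← zpow_add₀ hq,
    ← Finset.sum_add_distrib]
  simp only [Pi.add_apply, add_mul]

/-- The indicator function of a set of indices. -/
def ind (I : Finset (Fin n)) (i : Fin n) : ℤ := if i ∈ I then 1 else 0

theorem qShift_eq (I : Finset (Fin n)) (f : AsympSeries n) : qShift q I f = shiftHom q (ind I) f := by
  ext β
  rw [coeff_shiftHom hq]
  change (∏ i ∈ I, q ^ expo β i) * _ = _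
  rw [prod_zpow_eq hq]
  simp [ind]

theorem shiftHom_C (M : Fin n → ℤ) (c : ℂ) :
    shiftHom q M (MvPowerSeries.C c) = (MvPowerSeries.C c : AsympSeries n) := by
  classical
  ext β
  rw [coeff_shiftHom hq, MvPowerSeries.coeff_C]
  split_ifs with h
  · simp [h, expo]
  · simp

theorem shiftHom_X (M : Fin n → ℤ) (k : Fin n) :
    shiftHom q M (MvPowerSeries.X k) =
      (MvPowerSeries.C (q ^ (M k - M (k - 1))) * MvPowerSeries.X k : AsympSeries n) := by
  classical
  ext β
  rw [shiftHom, MvPowerSeries.coeff_rescale, MvPowerSeries.coeff_C_mul, MvPowerSeries.coeff_X]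
  split_ifs with h
  · rw [h]; simp
  · simp

theorem shiftHom_xprod (M : Fin n → ℤ) (S : Finset (Fin n)) :
    shiftHom q M (xprod S) =
      MvPowerSeries.C (q ^ (∑ i, M i * (ind S i - ind S (i + 1)))) * xprod S := by
  rw [xprod, map_prod, Finset.prod_congr rfl fun k _ => shiftHom_X hq M k,
    Finset.prod_mul_distrib, ← map_prod, prod_zpow_eq hq, sum_mul_sub_add_one]
  simp [ind]

theorem shiftHom_nome (M : Fin n → ℤ) : shiftHom q M (nome n) = nome n := by
  have := shiftHom_xprod hq M (Finset.univ : Finset (Fin n))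
  simpa [ind, xprod, nome] using this

theorem shiftHom_cyc (M : Fin n → ℤ) {i j : Fin n} (h : i ≠ j) :
    shiftHom q M (xprod (cyc i j)) = MvPowerSeries.C (q ^ (M j - M i)) * xprod (cyc i j) := by
  rw [shiftHom_xprod hq]
  congr 3
  simp only [ind]
  rw [Finset.sum_congr rfl fun k _ => by rw [indicator_cyc_sub h k]]
  simp [mul_sub]

theorem shiftHom_pochhammer (M : Fin n → ℤ) (a : AsympSeries n) :
    shiftHom q M (pochhammer a) = pochhammer (shiftHom q M a) :=
  map_pochhammer _ _ id (fun _ => rfl) (fun f β => coeff_shiftHom hq M f β) (shiftHom_nome hq M) a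

theorem shiftHom_thetaPair (M : Fin n → ℤ) (c : ℂ) {i j : Fin n} (h : i ≠ j) :
    shiftHom q M (thetaPair c i j) = thetaPair (c * q ^ (M i - M j)) i j := by
  rw [thetaPair, map_mul, shiftHom_pochhammer hq, shiftHom_pochhammer hq, map_mul, map_mul,
    shiftHom_cyc hq M h, shiftHom_cyc hq M h.symm, shiftHom_C hq, shiftHom_C hq, thetaPair,
    ← mul_assoc, ← mul_assoc, ← map_mul, ← map_mul, mul_inv, ← zpow_neg, neg_sub]

theorem shiftHom_inv (M : Fin n → ℤ) {f : AsympSeries n}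
    (hf : MvPowerSeries.constantCoeff f = 1) : shiftHom q M f⁻¹ = (shiftHom q M f)⁻¹ := by
  have h0 : MvPowerSeries.constantCoeff (shiftHom q M f) ≠ 0 := by
    rw [← MvPowerSeries.coeff_zero_eq_constantCoeff_apply, coeff_shiftHom hq,
      MvPowerSeries.coeff_zero_eq_constantCoeff_apply, hf]
    simp [expo]
  rw [MvPowerSeries.eq_inv_iff_mul_eq_one h0, ← map_mul,
    MvPowerSeries.inv_mul_cancel _ (by rw [hf]; exact one_ne_zero), map_one]

omit hq in
/-- The pair factor with both arguments multiplied by `q ^ e`. -/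
noncomputable def pairShift (q t : ℂ) (e : ℤ) (i j : Fin n) : AsympSeries n :=
  pairCoeff (t * q ^ e) (q ^ e) i j

theorem shiftHom_pairShift (M : Fin n → ℤ) (t : ℂ) (e : ℤ) {i j : Fin n} (h : i ≠ j) :
    shiftHom q M (pairShift q t e i j) = pairShift q t (e + (M i - M j)) i j := by
  rw [pairShift, pairCoeff, map_mul, shiftHom_inv hq M (constantCoeff_thetaPair _ _ _),
    shiftHom_thetaPair hq M _ h, shiftHom_thetaPair hq M _ h, pairShift, pairCoeff, zpow_add₀ hq,
    mul_assoc]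

omit hq in
theorem opCoeff_eq_pairShift (q t : ℂ) (I : Finset (Fin n)) :
    opCoeff t I = ∏ i ∈ I, ∏ j ∈ Iᶜ, pairShift q t 0 i j := by
  rw [opCoeff_eq]
  simp [pairShift]

theorem shiftHom_opCoeff (M : Fin n → ℤ) (t : ℂ) (I : Finset (Fin n)) :
    shiftHom q M (opCoeff t I) = ∏ i ∈ I, ∏ j ∈ Iᶜ, pairShift q t (M i - M j) i j := by
  rw [opCoeff_eq_pairShift q, map_prod]
  refine Finset.prod_congr rfl fun i hi => ?_
  rw [map_prod]
  refine Finset.prod_congr rfl fun j hj => ?_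
  have hij : i ≠ j := fun h => Finset.mem_compl.1 hj (h ▸ hi)
  rw [shiftHom_pairShift hq M t 0 hij, zero_add]

omit hq in
theorem prod_compl_singleton {R : Type*} [CommMonoid R] {i : Fin n} {J : Finset (Fin n)}
    (hi : i ∈ J) (g : Fin n → R) :
    ∏ k ∈ ({i} : Finset (Fin n))ᶜ, g k = (∏ k ∈ J.erase i, g k) * ∏ k ∈ Jᶜ, g k := by
  rw [← Finset.prod_union]
  · congr 1
    ext k
    by_cases hk : k ∈ J
    · simp [hk]
    · have : k ≠ i := fun h => hk (h ▸ hi)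
      simp [hk, this]
  · rw [Finset.disjoint_left]
    intro k hk hk'
    exact Finset.mem_compl.1 hk' (Finset.mem_of_mem_erase hk)

/-- Only the pairs `(i, k)` with `k ∉ J` feel a shift, and for them `T_i` and `T^J` have the same
effect. These terms of the commutator therefore cancel one by one. -/
theorem opCoeff_singleton_mul_of_mem (t : ℂ) {i : Fin n} {J : Finset (Fin n)} (hi : i ∈ J) :
    opCoeff t {i} * shiftHom q (ind {i}) (opCoeff t J) =
      opCoeff t J * shiftHom q (ind J) (opCoeff t {i}) := by
  rw [shiftHom_opCoeff hq, shiftHom_opCoeff hq, opCoeff_eq_pairShift q t {i},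
    opCoeff_eq_pairShift q t J, Finset.prod_singleton, Finset.prod_singleton,
    prod_compl_singleton hi, prod_compl_singleton hi, ← Finset.mul_prod_erase J _ hi,
    ← Finset.mul_prod_erase J _ hi]
  have h1 : ∏ j ∈ J.erase i, ∏ k ∈ Jᶜ, pairShift q t (ind {i} j - ind {i} k) j k =
      ∏ j ∈ J.erase i, ∏ k ∈ Jᶜ, pairShift q t 0 j k := by
    refine Finset.prod_congr rfl fun j hj => Finset.prod_congr rfl fun k hk => ?_
    have hji : j ≠ i := Finset.ne_of_mem_erase hj
    have hki : k ≠ i := fun h => Finset.mem_compl.1 hk (h ▸ hi)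
    simp [ind, hji, hki]
  have h2 : ∏ k ∈ Jᶜ, pairShift q t (ind {i} i - ind {i} k) i k =
      ∏ k ∈ Jᶜ, pairShift q t (ind J i - ind J k) i k := by
    refine Finset.prod_congr rfl fun k hk => ?_
    have hkJ := Finset.mem_compl.1 hk
    have hki : k ≠ i := fun h => hkJ (h ▸ hi)
    simp [ind, hki, hkJ, hi]
  have h3 : ∏ k ∈ J.erase i, pairShift q t (ind J i - ind J k) i k =
      ∏ k ∈ J.erase i, pairShift q t 0 i k := by
    refine Finset.prod_congr rfl fun k hk => ?_
    simp [ind, hi, Finset.mem_of_mem_erase hk]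
  rw [h1, h2, h3]
  ring

/-- The pairs leaving `K` form a factor independent of `i`; what remains involves pairs inside `K`
only. In the opposite order of composition the same factor appears, so the comparison reduces to
`sum_prod_pairShift`. -/
theorem opCoeff_singleton_mul_erase (t : ℂ) {i : Fin n} {K : Finset (Fin n)} (hi : i ∈ K) :
    opCoeff t {i} * shiftHom q (ind {i}) (opCoeff t (K.erase i)) =
      (∏ j ∈ K, ∏ k ∈ Kᶜ, pairShift q t 0 j k) *
        ∏ j ∈ K.erase i, (pairShift q t 0 i j * pairShift q t (-1) j i) := by
  have hc : (K.erase i)ᶜ = insert i Kᶜ := Finset.compl_erase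
  have hiK : i ∉ Kᶜ := fun h => Finset.mem_compl.1 h hi
  rw [shiftHom_opCoeff hq, opCoeff_eq_pairShift q t {i}, Finset.prod_singleton,
    prod_compl_singleton hi, ← Finset.mul_prod_erase K _ hi, hc]
  have h1 : ∏ j ∈ K.erase i, ∏ k ∈ insert i Kᶜ, pairShift q t (ind {i} j - ind {i} k) j k =
      (∏ j ∈ K.erase i, pairShift q t (-1) j i) *
        ∏ j ∈ K.erase i, ∏ k ∈ Kᶜ, pairShift q t 0 j k := by
    rw [← Finset.prod_mul_distrib]
    refine Finset.prod_congr rfl fun j hj => ?_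
    have hji : j ≠ i := Finset.ne_of_mem_erase hj
    rw [Finset.prod_insert hiK]
    have e1 : ind {i} j - ind {i} i = -1 := by simp [ind, hji]
    have e2 : ∀ k ∈ Kᶜ, ind {i} j - ind {i} k = 0 := fun k hk => by
      have hki : k ≠ i := fun h => hiK (h ▸ hk)
      simp [ind, hji, hki]
    rw [e1, Finset.prod_congr rfl fun k hk => by rw [e2 k hk]]
  rw [h1, Finset.prod_mul_distrib]
  ring

theorem opCoeff_erase_mul_singleton (t : ℂ) {i : Fin n} {K : Finset (Fin n)} (hi : i ∈ K) :
    opCoeff t (K.erase i) * shiftHom q (ind (K.erase i)) (opCoeff t {i}) =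
      (∏ j ∈ K, ∏ k ∈ Kᶜ, pairShift q t 0 j k) *
        ∏ j ∈ K.erase i, (pairShift q t 0 j i * pairShift q t (-1) i j) := by
  have hc : (K.erase i)ᶜ = insert i Kᶜ := Finset.compl_erase
  have hiK : i ∉ Kᶜ := fun h => Finset.mem_compl.1 h hi
  rw [shiftHom_opCoeff hq, opCoeff_eq_pairShift q t (K.erase i), Finset.prod_singleton,
    prod_compl_singleton hi, ← Finset.mul_prod_erase K _ hi, hc]
  have h1 : ∏ j ∈ K.erase i, ∏ k ∈ insert i Kᶜ, pairShift q t 0 j k =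
      (∏ j ∈ K.erase i, pairShift q t 0 j i) *
        ∏ j ∈ K.erase i, ∏ k ∈ Kᶜ, pairShift q t 0 j k := by
    rw [← Finset.prod_mul_distrib]
    exact Finset.prod_congr rfl fun j _ => Finset.prod_insert hiK
  have h2 : ∏ k ∈ K.erase i, pairShift q t (ind (K.erase i) i - ind (K.erase i) k) i k =
      ∏ k ∈ K.erase i, pairShift q t (-1) i k := by
    refine Finset.prod_congr rfl fun k hk => ?_
    simp only [ind, hk, if_true, Finset.notMem_erase, if_false, zero_sub]
  have h3 : ∏ k ∈ Kᶜ, pairShift q t (ind (K.erase i) i - ind (K.erase i) k) i k =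
      ∏ k ∈ Kᶜ, pairShift q t 0 i k := by
    refine Finset.prod_congr rfl fun k hk => ?_
    have hkK := Finset.mem_compl.1 hk
    simp [ind, hkK]
  rw [h1, h2, h3, Finset.prod_mul_distrib]
  ring

end Shift

/-! ### The theta identity for the pair factors -/

section PairIdentity

variable {n : ℕ} [NeZero n]

/-- The expansion in powers of the nome, with values in a field. -/
noncomputable def nomeField (n : ℕ) [NeZero n] :
    AsympSeries n →+* FractionRing (PowerSeries (AsympField n)) :=
  (algebraMap _ _).comp (nomeExpansion n)

theorem nomeField_injective : Function.Injective (nomeField n) :=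
  (IsFractionRing.injective _ _).comp nomeExpansion_injective

/-- The theta function with values in the field of `nomeField`. -/
noncomputable def fieldTheta (u : (AsympField n)ˣ) : FractionRing (PowerSeries (AsympField n)) :=
  thetaVal (algebraMap (PowerSeries (AsympField n)) _) u

theorem nomeField_thetaPair (c : ℂˣ) {i j : Fin n} (h : i ≠ j) :
    nomeField n (thetaPair (c : ℂ) i j) =
      if i < j then fieldTheta (ratioUnit c i j)⁻¹ else fieldTheta (ratioUnit c i j) := by
  rw [nomeField, RingHom.comp_apply, nomeExpansion_thetaPair c h]
  split_ifs <;> rfl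

theorem nomeField_thetaPair_ne_zero (c : ℂ) (i j : Fin n) :
    nomeField n (thetaPair c i j) ≠ 0 := by
  rw [Ne, map_eq_zero_iff _ nomeField_injective]
  intro h0
  have := constantCoeff_thetaPair c i j
  rw [h0, map_zero] at this
  exact zero_ne_one this

/-- For `i < j` each factor is a theta function of the inverse argument, which differs from the
desired one by a sign and a monomial. The condition on the constants makes these monomials cancel in
the quotient. -/
theorem nomeField_thetaPair_div (c₁ c₂ d₁ d₂ : ℂˣ) (hcd : c₁ * c₂ = d₁ * d₂) {i j : Fin n}
    (h : i ≠ j) :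
    nomeField n (thetaPair (c₁ : ℂ) i j) * nomeField n (thetaPair (c₂ : ℂ) i j) /
        (nomeField n (thetaPair (d₁ : ℂ) i j) * nomeField n (thetaPair (d₂ : ℂ) i j)) =
      fieldTheta (ratioUnit c₁ i j) * fieldTheta (ratioUnit c₂ i j) /
        (fieldTheta (ratioUnit d₁ i j) * fieldTheta (ratioUnit d₂ i j)) := by
  simp only [nomeField_thetaPair _ h]
  split_ifs
  · set κ : (AsympField n)ˣ → FractionRing (PowerSeries (AsympField n)) := fun u =>
      algebraMap (PowerSeries (AsympField n)) _ (PowerSeries.C (u : AsympField n)) with hκ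
    have hinv : ∀ u, fieldTheta u⁻¹ = -(κ u)⁻¹ * fieldTheta u := fun u => thetaVal_inv _ u
    have hmul : ∀ u v, κ u * κ v = κ (u * v) := by
      intro u v
      simp only [hκ, Units.val_mul, map_mul]
    have hne : ∀ u, κ u ≠ 0 := by
      intro u hu
      have := hmul u u⁻¹
      rw [hu, zero_mul, mul_inv_cancel] at this
      simp [hκ] at this
    have hκκ : κ (ratioUnit c₁ i j) * κ (ratioUnit c₂ i j) =
        κ (ratioUnit d₁ i j) * κ (ratioUnit d₂ i j) := by
      rw [hmul, hmul]
      congr 1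
      simp only [ratioUnit]
      rw [mul_mul_mul_comm, mul_mul_mul_comm (constUnit n d₁), ← map_mul, ← map_mul, hcd]
    rw [hinv, hinv, hinv, hinv, mul_mul_mul_comm, mul_mul_mul_comm (-(κ (ratioUnit d₁ i j))⁻¹),
      neg_mul_neg, neg_mul_neg, ← mul_inv, ← mul_inv, hκκ,
      mul_div_mul_left _ _ (inv_ne_zero (mul_ne_zero (hne _) (hne _)))]
  · rfl

theorem nomeField_pairCoeff (c d : ℂ) (i j : Fin n) :
    nomeField n (pairCoeff c d i j) =
      nomeField n (thetaPair c i j) / nomeField n (thetaPair d i j) := by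
  rw [pairCoeff, map_mul, div_eq_mul_inv]
  congr 1
  refine eq_inv_of_mul_eq_one_left ?_
  rw [← map_mul, MvPowerSeries.inv_mul_cancel _ (by
    rw [constantCoeff_thetaPair]; exact one_ne_zero), map_one]

theorem sum_prod_pairShift {q t : ℂ} (hq : q ≠ 0) (hq1 : q ≠ 1) (ht : t ≠ 0)
    (K : Finset (Fin n)) :
    ∑ i ∈ K, ∏ j ∈ K.erase i, (pairShift q t 0 i j * pairShift q t (-1) j i) =
      ∑ i ∈ K, ∏ j ∈ K.erase i, (pairShift q t 0 j i * pairShift q t (-1) i j) := by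
  apply nomeField_injective
  lift q to ℂˣ using hq.isUnit
  lift t to ℂˣ using ht.isUnit
  simp only [map_sum, map_prod, map_mul]
  have hL : ∀ i j : Fin n, nomeField n (pairShift q t 0 i j) *
      nomeField n (pairShift q t (-1) j i) =
        nomeField n (thetaPair (t : ℂ) i j) * nomeField n (thetaPair (↑(q / t) : ℂ) i j) /
        (nomeField n (thetaPair ((1 : ℂˣ) : ℂ) i j) * nomeField n (thetaPair (q : ℂ) i j)) := by
    intro i j
    rw [pairShift, pairShift, nomeField_pairCoeff, nomeField_pairCoeff,
      ← thetaPair_inv (_ * _) i j, ← thetaPair_inv (_ ^ _) i j, div_mul_div_comm]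
    simp [div_eq_mul_inv]
  have hR : ∀ i j : Fin n, nomeField n (pairShift q t 0 j i) *
      nomeField n (pairShift q t (-1) i j) =
        nomeField n (thetaPair (↑t⁻¹ : ℂ) i j) * nomeField n (thetaPair (↑(t / q) : ℂ) i j) /
        (nomeField n (thetaPair ((1 : ℂˣ) : ℂ) i j) *
          nomeField n (thetaPair (↑q⁻¹ : ℂ) i j)) := by
    intro i j
    rw [pairShift, pairShift, nomeField_pairCoeff, nomeField_pairCoeff,
      ← thetaPair_inv (_ * _) i j, ← thetaPair_inv (_ ^ _) i j, div_mul_div_comm]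
    simp [div_eq_mul_inv]
  rw [Finset.sum_congr rfl fun i _ => Finset.prod_congr rfl fun j _ => hL i j,
    Finset.sum_congr rfl fun i _ => Finset.prod_congr rfl fun j _ => hR i j]
  -- At these values the common factor in `sum_prod_thetaVal_eq` vanishes, but here every quotient
  -- is `1` on both sides.
  by_cases htriv : t = 1 ∨ t = q
  · refine Finset.sum_congr rfl fun i _ => Finset.prod_congr rfl fun j _ => ?_
    have hne := fun c : ℂ => nomeField_thetaPair_ne_zero c i j
    rcases htriv with rfl | rfl
    · rw [div_one, one_div, inv_one, div_self (mul_ne_zero (hne _) (hne _)),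
        div_self (mul_ne_zero (hne _) (hne _))]
    · rw [div_self', mul_comm, div_self (mul_ne_zero (hne _) (hne _)), mul_comm,
        div_self (mul_ne_zero (hne _) (hne _))]
  · push Not at htriv
    have hinj : Function.Injective (constUnit n) := by
      intro c d hcd
      have := congrArg Units.val hcd
      rw [constUnit_val, constUnit_val] at this
      exact Units.ext (MvPowerSeries.C_injective (IsFractionRing.injective _ _ this))
    rw [Finset.sum_congr rfl fun i _ => Finset.prod_congr rfl fun j hj =>
        nomeField_thetaPair_div t (q / t) 1 q (by simp) (Finset.ne_of_mem_erase hj).symm,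
      Finset.sum_congr rfl fun i _ => Finset.prod_congr rfl fun j hj =>
        nomeField_thetaPair_div t⁻¹ (t / q) 1 q⁻¹ (by
          rw [one_mul, div_eq_mul_inv, inv_mul_cancel_left]) (Finset.ne_of_mem_erase hj).symm]
    have key := sum_prod_thetaVal_eq
      (φ := algebraMap (PowerSeries (AsympField n)) (FractionRing (PowerSeries (AsympField n))))
      (IsFractionRing.injective _ _) K coord (constUnit n q) (constUnit n t)
      (fun h => hq1 (by simpa using congrArg Units.val (hinj (h.trans (map_one _).symm))))
      (fun h => htriv.1 (hinj (h.trans (map_one _).symm))) (fun h => htriv.2 (hinj h))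
      (fun i _ j _ hij => ⟨by simpa using coord_ne_const_mul 1 hij, by
        have := coord_ne_const_mul q⁻¹ hij
        rwa [map_inv, inv_mul_eq_div] at this⟩)
    simpa only [fieldTheta, ratioUnit, map_one, one_mul, map_div, map_inv] using key

end PairIdentity

/-! ### Commutation with the first-order operator -/

section Commutation

variable {n : ℕ} [NeZero n]

/-- The operator `∑_I w_I 𝓑_I T^I` with arbitrary weights. -/
noncomputable def weightedOp (q t : ℂ) (w : Finset (Fin n) → ℂ) :
    AsympSeries n →ₗ[ℂ] AsympSeries n where
  toFun f := ∑ I, MvPowerSeries.C (w I) * opCoeff t I * shiftHom q (ind I) f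
  map_add' f g := by simp only [map_add, mul_add, Finset.sum_add_distrib]
  map_smul' c f := by
    simp only [MvPowerSeries.smul_eq_C_mul, map_mul, RingHom.id_apply, Finset.mul_sum]
    refine Finset.sum_congr rfl fun I _ => ?_
    rw [show shiftHom q (ind I) (MvPowerSeries.C c) = (MvPowerSeries.C c : AsympSeries n) by
      classical
      ext β
      rw [shiftHom, MvPowerSeries.coeff_rescale, MvPowerSeries.coeff_C]
      split_ifs with h
      · simp [h]
      · simp]
    ring

theorem weightedOp_apply (q t : ℂ) (w : Finset (Fin n) → ℂ) (f : AsympSeries n) :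
    weightedOp q t w f = ∑ I, MvPowerSeries.C (w I) * opCoeff t I * shiftHom q (ind I) f := rfl

/-- The weights `s^I` of the `r`-th operator. -/
def weight (s : Fin n → ℂ) (r : ℕ) (I : Finset (Fin n)) : ℂ :=
  if I.card = r then ∏ i ∈ I, s i else 0

variable {q : ℂ}

theorem modifiedOp_eq_sum (hq : q ≠ 0) (t : ℂ) (s : Fin n → ℂ) (r : ℕ) (f : AsympSeries n) :
    modifiedOp q t s r f = ∑ I ∈ (Finset.univ : Finset (Fin n)).powersetCard r,
      MvPowerSeries.C (∏ i ∈ I, s i) * opCoeff t I * shiftHom q (ind I) f := by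
  simp only [modifiedOp, qShift_eq hq]

theorem modifiedOp_eq_weightedOp (hq : q ≠ 0) (t : ℂ) (s : Fin n → ℂ) (r : ℕ) (f : AsympSeries n) :
    modifiedOp q t s r f = weightedOp q t (weight s r) f := by
  rw [modifiedOp_eq_sum hq, weightedOp_apply]
  have : (Finset.univ : Finset (Fin n)).powersetCard r =
      Finset.univ.filter fun I => I.card = r := by
    ext I; simp [Finset.mem_powersetCard]
  rw [this, Finset.sum_filter]
  refine Finset.sum_congr rfl fun I _ => ?_
  unfold weight
  split_ifs <;> simp

theorem weightedOp_weightedOp (hq : q ≠ 0) (t : ℂ) (w w' : Finset (Fin n) → ℂ)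
    (f : AsympSeries n) :
    weightedOp q t w (weightedOp q t w' f) = ∑ I, ∑ J, MvPowerSeries.C (w I * w' J) *
      (opCoeff t I * shiftHom q (ind I) (opCoeff t J)) * shiftHom q (ind I + ind J) f := by
  rw [weightedOp_apply]
  refine Finset.sum_congr rfl fun I _ => ?_
  rw [weightedOp_apply, map_sum, Finset.mul_sum]
  refine Finset.sum_congr rfl fun J _ => ?_
  simp only [map_mul, shiftHom_C hq, shiftHom_shiftHom hq]
  ring

theorem sum_powersetCard_insert {R : Type*} [AddCommMonoid R] (r : ℕ)
    (F : Fin n → Finset (Fin n) → R) :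
    ∑ i, ∑ J ∈ (Finset.univ : Finset (Fin n)).powersetCard r with i ∉ J, F i J =
      ∑ K ∈ (Finset.univ : Finset (Fin n)).powersetCard (r + 1), ∑ i ∈ K, F i (K.erase i) := by
  rw [Finset.sum_sigma', Finset.sum_sigma']
  refine Finset.sum_bij' (fun x _ => ⟨insert x.1 x.2, x.1⟩) (fun y _ => ⟨y.2, y.1.erase y.2⟩)
    ?_ ?_ ?_ ?_ ?_
  · rintro ⟨i, J⟩ h
    simp only [Finset.mem_sigma, Finset.mem_univ, true_and, Finset.mem_filter,
      Finset.mem_powersetCard, Finset.subset_univ] at h ⊢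
    exact ⟨by rw [Finset.card_insert_of_notMem h.2, h.1], Finset.mem_insert_self _ _⟩
  · rintro ⟨K, i⟩ h
    simp only [Finset.mem_sigma, Finset.mem_univ, true_and, Finset.mem_filter,
      Finset.mem_powersetCard, Finset.subset_univ] at h ⊢
    exact ⟨by rw [Finset.card_erase_of_mem h.2, h.1]; rfl, Finset.notMem_erase _ _⟩
  · rintro ⟨i, J⟩ h
    simp only [Finset.mem_sigma, Finset.mem_univ, true_and, Finset.mem_filter] at h
    simp [Finset.erase_insert h.2]
  · rintro ⟨K, i⟩ h
    simp only [Finset.mem_sigma] at h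
    simp [Finset.insert_erase h.2]
  · rintro ⟨i, J⟩ h
    simp only [Finset.mem_sigma, Finset.mem_univ, true_and, Finset.mem_filter] at h
    simp [Finset.erase_insert h.2]

theorem ind_singleton_add_erase {i : Fin n} {K : Finset (Fin n)} (hi : i ∈ K) :
    ind {i} + ind (K.erase i) = ind K := by
  funext j
  by_cases hj : j = i
  · subst hj; simp [ind, hi]
  · simp [ind, hj]

theorem modifiedOp_one_eq (hq : q ≠ 0) (t : ℂ) (s : Fin n → ℂ) (g : AsympSeries n) :
    modifiedOp q t s 1 g =
      ∑ i, MvPowerSeries.C (s i) * opCoeff t {i} * shiftHom q (ind {i}) g := by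
  rw [modifiedOp_eq_sum hq, Finset.powersetCard_one, Finset.sum_map]
  simp

theorem modifiedOp_one_modifiedOp (hq : q ≠ 0) (t : ℂ) (s : Fin n → ℂ) (r : ℕ)
    (f : AsympSeries n) :
    modifiedOp q t s 1 (modifiedOp q t s r f) =
      ∑ i, ∑ J ∈ (Finset.univ : Finset (Fin n)).powersetCard r,
        MvPowerSeries.C (s i * ∏ j ∈ J, s j) *
          (opCoeff t {i} * shiftHom q (ind {i}) (opCoeff t J)) *
            shiftHom q (ind {i} + ind J) f := by
  rw [modifiedOp_one_eq hq]
  refine Finset.sum_congr rfl fun i _ => ?_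
  rw [modifiedOp_eq_sum hq, map_sum, Finset.mul_sum]
  refine Finset.sum_congr rfl fun J _ => ?_
  simp only [map_mul, shiftHom_C hq, shiftHom_shiftHom hq]
  ring

theorem modifiedOp_modifiedOp_one (hq : q ≠ 0) (t : ℂ) (s : Fin n → ℂ) (r : ℕ)
    (f : AsympSeries n) :
    modifiedOp q t s r (modifiedOp q t s 1 f) =
      ∑ i, ∑ J ∈ (Finset.univ : Finset (Fin n)).powersetCard r,
        MvPowerSeries.C (s i * ∏ j ∈ J, s j) *
          (opCoeff t J * shiftHom q (ind J) (opCoeff t {i})) *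
            shiftHom q (ind {i} + ind J) f := by
  rw [modifiedOp_eq_sum hq, modifiedOp_one_eq hq, Finset.sum_comm]
  refine Finset.sum_congr rfl fun J _ => ?_
  rw [map_sum, Finset.mul_sum]
  refine Finset.sum_congr rfl fun i _ => ?_
  simp only [map_mul, shiftHom_C hq, shiftHom_shiftHom hq, add_comm (ind {i})]
  ring

theorem sum_opCoeff_comm (hq : q ≠ 0) (hq1 : q ≠ 1) {t : ℂ} (ht : t ≠ 0) (K : Finset (Fin n)) :
    ∑ i ∈ K, opCoeff t {i} * shiftHom q (ind {i}) (opCoeff t (K.erase i)) =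
      ∑ i ∈ K, opCoeff t (K.erase i) * shiftHom q (ind (K.erase i)) (opCoeff t {i}) := by
  rw [Finset.sum_congr rfl fun i hi => opCoeff_singleton_mul_erase hq t hi,
    Finset.sum_congr rfl fun i hi => opCoeff_erase_mul_singleton hq t hi,
    ← Finset.mul_sum, ← Finset.mul_sum, sum_prod_pairShift hq hq1 ht K]

/-- Terms with `i ∈ J` agree individually. Those with `i ∉ J` are grouped by `K = J ∪ {i}`, on which
`s^K` and `T^K` are constant, and agree after summation over `i ∈ K`. -/
theorem modifiedOp_one_comm (hq : q ≠ 0) (hq1 : q ≠ 1) {t : ℂ} (ht : t ≠ 0) (s : Fin n → ℂ)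
    (r : ℕ) (f : AsympSeries n) :
    modifiedOp q t s 1 (modifiedOp q t s r f) = modifiedOp q t s r (modifiedOp q t s 1 f) := by
  rw [modifiedOp_one_modifiedOp hq, modifiedOp_modifiedOp_one hq]
  have hsplit : ∀ F : Fin n → Finset (Fin n) → AsympSeries n,
      ∑ i, ∑ J ∈ (Finset.univ : Finset (Fin n)).powersetCard r, F i J =
        ∑ i, ∑ J ∈ (Finset.univ : Finset (Fin n)).powersetCard r with i ∈ J, F i J +
          ∑ i, ∑ J ∈ (Finset.univ : Finset (Fin n)).powersetCard r with i ∉ J, F i J := by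
    intro F
    rw [← Finset.sum_add_distrib]
    exact Finset.sum_congr rfl fun i _ => (Finset.sum_filter_add_sum_filter_not _ _ _).symm
  rw [hsplit, hsplit, sum_powersetCard_insert, sum_powersetCard_insert]
  refine congrArg₂ _ ?_ ?_
  · refine Finset.sum_congr rfl fun i _ => Finset.sum_congr rfl fun J hJ => ?_
    rw [opCoeff_singleton_mul_of_mem hq t (Finset.mem_filter.1 hJ).2]
  · refine Finset.sum_congr rfl fun K _ => ?_
    have e : ∀ G : Fin n → AsympSeries n,
        ∑ i ∈ K, MvPowerSeries.C (s i * ∏ j ∈ K.erase i, s j) * G i *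
            shiftHom q (ind {i} + ind (K.erase i)) f =
          MvPowerSeries.C (∏ j ∈ K, s j) * (∑ i ∈ K, G i) * shiftHom q (ind K) f := by
      intro G
      rw [Finset.mul_sum, Finset.sum_mul]
      refine Finset.sum_congr rfl fun i hi => ?_
      rw [Finset.mul_prod_erase K s hi, ind_singleton_add_erase hi]
    rw [e fun i => opCoeff t {i} * shiftHom q (ind {i}) (opCoeff t (K.erase i)),
      e fun i => opCoeff t (K.erase i) * shiftHom q (ind (K.erase i)) (opCoeff t {i}),
      sum_opCoeff_comm hq hq1 ht K]

end Commutation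

/-! ### Triangularity and normalized eigenfunctions -/

section Triangular

variable {n : ℕ} [NeZero n]

/-- The exponent `(k, …, k)` of `p ^ k`. -/
noncomputable def constExp (n k : ℕ) : Fin n →₀ ℕ := Finsupp.equivFunOnFinite.symm fun _ => k

theorem constExp_apply (k : ℕ) (i : Fin n) : constExp n k i = k := rfl

theorem constExp_zero : constExp n 0 = 0 := by ext; rfl

theorem eq_constExp {β : Fin n →₀ ℕ} (h : ∀ i, β i = β 0) : β = constExp n (β 0) := by
  ext i; exact h i

theorem coeff_ofNomeSeries (ε : PowerSeries ℂ) (β : Fin n →₀ ℕ) :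
    MvPowerSeries.coeff β (ofNomeSeries ε) =
      if ∀ i, β i = β 0 then PowerSeries.coeff (β 0) ε else 0 := rfl

theorem coeff_ofNomeSeries_ne_zero {ε : PowerSeries ℂ} {β : Fin n →₀ ℕ}
    (h : MvPowerSeries.coeff β (ofNomeSeries ε) ≠ 0) : β = constExp n (β 0) := by
  rw [coeff_ofNomeSeries] at h
  by_contra h'
  exact h (if_neg fun h0 => h' (eq_constExp h0))

theorem coeff_constExp_ofNomeSeries (ε : PowerSeries ℂ) (k : ℕ) :
    MvPowerSeries.coeff (constExp n k) (ofNomeSeries ε : AsympSeries n) =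
      PowerSeries.coeff k ε := by
  simp [coeff_ofNomeSeries, constExp_apply]

theorem expo_constExp (k : ℕ) : expo (constExp n k) = 0 := by
  funext i; simp [expo, constExp_apply]

theorem eq_constExp_of_expo_eq_zero {β : Fin n →₀ ℕ} (h : expo β = 0) : β = constExp n (β 0) := by
  refine eq_constExp fun i => ?_
  have hstep : ∀ i : Fin n, β i = β (i + 1) := fun i => by
    have := congrFun h i
    simp only [expo, Pi.zero_apply] at this
    omega
  have : ∀ (m : ℕ) (hm : m < n), β ⟨m, hm⟩ = β 0 := by
    intro m
    induction m with
    | zero => intro hm; rfl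
    | succ m ih =>
      intro hm
      rw [← ih (by omega), hstep ⟨m, by omega⟩]
      congr 1
      refine Fin.ext ?_
      rw [val_add_one_eq, if_neg (by simp only; omega)]
  exact this i.val i.isLt

theorem add_eq_lt {α γ β : Fin n →₀ ℕ} (h : α + γ = β) (hα : α ≠ 0) : γ < β := by
  rw [← h]
  exact lt_add_of_pos_left γ (pos_iff_ne_zero.2 hα)

theorem coeff_mul_of_forall_lt (g h : AsympSeries n) (β : Fin n →₀ ℕ)
    (hh : ∀ γ < β, MvPowerSeries.coeff γ h = 0) :
    MvPowerSeries.coeff β (g * h) =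
      MvPowerSeries.constantCoeff g * MvPowerSeries.coeff β h := by
  classical
  rw [MvPowerSeries.coeff_mul, Finset.sum_eq_single (0, β)]
  · rw [MvPowerSeries.coeff_zero_eq_constantCoeff_apply]
  · rintro ⟨α, γ⟩ hx hne
    have hx' := Finset.HasAntidiagonal.mem_antidiagonal.1 hx
    simp only at hx'
    have hα : α ≠ 0 := by
      rintro rfl
      exact hne (by rw [← hx', zero_add])
    rw [hh γ (add_eq_lt hx' hα), mul_zero]
  · intro h0
    exact absurd (Finset.HasAntidiagonal.mem_antidiagonal.2 (zero_add β)) h0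

theorem constantCoeff_opCoeff (t : ℂ) (I : Finset (Fin n)) :
    MvPowerSeries.constantCoeff (opCoeff t I) = 1 := by
  rw [opCoeff_eq, map_prod]
  refine Finset.prod_eq_one fun i hi => ?_
  rw [map_prod]
  refine Finset.prod_eq_one fun j hj => ?_
  have hij : i ≠ j := fun h => Finset.mem_compl.1 hj (h ▸ hi)
  rw [pairCoeff, map_mul, MvPowerSeries.constantCoeff_inv, constantCoeff_thetaPair,
    constantCoeff_thetaPair, inv_one, mul_one]

/-- The diagonal entry of `weightedOp` at a monomial with exponents `l`. -/
noncomputable def diagEntry (q : ℂ) (w : Finset (Fin n) → ℂ) (l : Fin n → ℤ) : ℂ :=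
  ∑ I, w I * q ^ (∑ i, ind I i * l i)

variable {q : ℂ} (hq : q ≠ 0) (t : ℂ) (w : Finset (Fin n) → ℂ)
include hq

/-- Triangularity: each `𝓑_I` has constant coefficient `1`, so a monomial is sent to a multiple of
itself plus monomials of larger exponent. -/
theorem coeff_weightedOp_of_forall_lt (h : AsympSeries n) (β : Fin n →₀ ℕ)
    (hh : ∀ γ < β, MvPowerSeries.coeff γ h = 0) :
    MvPowerSeries.coeff β (weightedOp q t w h) =
      diagEntry q w (expo β) * MvPowerSeries.coeff β h := by
  rw [weightedOp_apply, map_sum, diagEntry, Finset.sum_mul]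
  refine Finset.sum_congr rfl fun I _ => ?_
  rw [coeff_mul_of_forall_lt _ _ β fun γ hγ => by rw [coeff_shiftHom hq, hh γ hγ, mul_zero],
    map_mul, constantCoeff_opCoeff, MvPowerSeries.constantCoeff_C, mul_one, coeff_shiftHom hq,
    mul_assoc]

theorem shiftHom_ofNomeSeries (M : Fin n → ℤ) (ε : PowerSeries ℂ) :
    shiftHom q M (ofNomeSeries ε) = (ofNomeSeries ε : AsympSeries n) := by
  ext β
  rw [coeff_shiftHom hq]
  by_cases h : MvPowerSeries.coeff β (ofNomeSeries ε : AsympSeries n) = 0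
  · rw [h, mul_zero]
  · rw [coeff_ofNomeSeries_ne_zero h, expo_constExp]
    simp

theorem weightedOp_ofNomeSeries_mul (ε : PowerSeries ℂ) (f : AsympSeries n) :
    weightedOp q t w (ofNomeSeries ε * f) = ofNomeSeries ε * weightedOp q t w f := by
  rw [weightedOp_apply, weightedOp_apply, Finset.mul_sum]
  refine Finset.sum_congr rfl fun I _ => ?_
  rw [map_mul, shiftHom_ofNomeSeries hq]
  ring

omit hq in
theorem constantCoeff_ofNomeSeries (ε : PowerSeries ℂ) :
    MvPowerSeries.constantCoeff (ofNomeSeries ε : AsympSeries n) = PowerSeries.coeff 0 ε := by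
  rw [← MvPowerSeries.coeff_zero_eq_constantCoeff_apply, ← constExp_zero,
    coeff_constExp_ofNomeSeries]

/-- The constant term of `f` with respect to `x` is `1`. -/
def IsNormalized (f : AsympSeries n) : Prop :=
  ∀ k : ℕ, MvPowerSeries.coeff (constExp n k) f = if k = 0 then 1 else 0

omit hq in
theorem IsNormalized.coeff_constExp_mul {f : AsympSeries n} (hf : IsNormalized f)
    (ε : PowerSeries ℂ) (k : ℕ) :
    MvPowerSeries.coeff (constExp n k) (ofNomeSeries ε * f) = PowerSeries.coeff k ε := by
  classical
  rw [MvPowerSeries.coeff_mul, Finset.sum_eq_single (constExp n k, 0)]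
  · have := hf 0
    rw [constExp_zero, if_pos rfl] at this
    rw [this, mul_one, coeff_constExp_ofNomeSeries]
  · rintro ⟨α, γ⟩ hx hne
    have hx' := Finset.HasAntidiagonal.mem_antidiagonal.1 hx
    simp only at hx' ⊢
    by_cases hα : MvPowerSeries.coeff α (ofNomeSeries ε : AsympSeries n) = 0
    · rw [hα, zero_mul]
    · have hα' := coeff_ofNomeSeries_ne_zero hα
      have hle : ∀ i, α i + γ i = k := fun i => by
        have := DFunLike.congr_fun hx' i
        simpa [constExp_apply] using this
      have hγ : γ = constExp n (γ 0) := eq_constExp fun i => by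
        have h1 := hle i
        have h2 := hle 0
        rw [hα', constExp_apply] at h1
        omega
      have hγ0 : γ 0 ≠ 0 := by
        intro h0
        apply hne
        rw [h0, constExp_zero] at hγ
        rw [hγ, ← hx', hγ, add_zero]
      rw [hγ, hf, if_neg hγ0, mul_zero]
  · intro h0
    exact absurd (Finset.HasAntidiagonal.mem_antidiagonal.2 (add_zero _)) h0

omit hq in
/-- A causal self-map of the coefficient functions has a unique fixed point. -/
theorem existsUnique_fixed_point {α R : Type*} [Preorder α] [WellFoundedLT α] [Zero R]
    (G : (α → R) → α → R) (hG : ∀ f g β, (∀ γ < β, f γ = g γ) → G f β = G g β) :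
    ∃! f, G f = f := by
  classical
  let f : α → R := (wellFounded_lt (α := α)).fix fun β rec =>
    G (fun γ => if h : γ < β then rec γ h else 0) β
  have hf : ∀ β, f β = G f β := by
    intro β
    have : f β = G (fun γ => if γ < β then f γ else 0) β := WellFounded.fix_eq _ _ _
    rw [this]
    exact hG _ _ _ fun γ hγ => if_pos hγ
  refine ⟨f, (funext hf).symm, fun g hg => ?_⟩
  funext β
  induction β using WellFoundedLT.induction with
  | _ β ih =>
    rw [hf, ← hg]
    exact hG _ _ _ fun γ hγ => ih γ hγ

/-- The operator is nondegenerate: its diagonal entries differ from the lowest one. -/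
def IsNondegenerate (q : ℂ) (w : Finset (Fin n) → ℂ) : Prop :=
  ∀ β : Fin n →₀ ℕ, β ≠ constExp n (β 0) → diagEntry q w (expo β) ≠ diagEntry q w 0

/-- The eigenvalue forced on a normalized eigenfunction `f`. -/
noncomputable def forcedEigenvalue (q t : ℂ) (w : Finset (Fin n) → ℂ) (f : AsympSeries n) :
    PowerSeries ℂ :=
  PowerSeries.mk fun k => if k = 0 then diagEntry q w 0 else
    MvPowerSeries.coeff (constExp n k) (weightedOp q t w f)

open Classical in
/-- The map whose fixed points are the normalized eigenfunctions. -/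
noncomputable def eigenStep (q t : ℂ) (w : Finset (Fin n) → ℂ) (f : AsympSeries n) :
    AsympSeries n := fun β : Fin n →₀ ℕ =>
  if β = constExp n (β 0) then (if β 0 = 0 then 1 else 0) else
    (diagEntry q w (expo β) - diagEntry q w 0)⁻¹ *
      (MvPowerSeries.coeff β (ofNomeSeries (forcedEigenvalue q t w f) * f) -
        MvPowerSeries.coeff β (weightedOp q t w f) +
        (diagEntry q w (expo β) - diagEntry q w 0) * MvPowerSeries.coeff β f)

omit hq in
theorem coeff_eigenStep_constExp (f : AsympSeries n) (k : ℕ) :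
    MvPowerSeries.coeff (constExp n k) (eigenStep q t w f) = if k = 0 then 1 else 0 := by
  change eigenStep q t w f (constExp n k) = _
  rw [eigenStep, if_pos (by rw [constExp_apply]), constExp_apply]

omit hq in
theorem coeff_eigenStep {β : Fin n →₀ ℕ} (hβ : β ≠ constExp n (β 0)) (f : AsympSeries n) :
    MvPowerSeries.coeff β (eigenStep q t w f) =
    (diagEntry q w (expo β) - diagEntry q w 0)⁻¹ *
      (MvPowerSeries.coeff β (ofNomeSeries (forcedEigenvalue q t w f) * f) -
        MvPowerSeries.coeff β (weightedOp q t w f) +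
        (diagEntry q w (expo β) - diagEntry q w 0) * MvPowerSeries.coeff β f) := by
  change eigenStep q t w f β = _
  rw [eigenStep, if_neg hβ]

/-- Causality of the recursion: the last summand of `eigenStep` cancels the dependence on the
coefficient at `β` itself. -/
theorem eigenStep_congr (f g : AsympSeries n) (β : Fin n →₀ ℕ)
    (h : ∀ γ < β, MvPowerSeries.coeff γ f = MvPowerSeries.coeff γ g) :
    MvPowerSeries.coeff β (eigenStep q t w f) = MvPowerSeries.coeff β (eigenStep q t w g) := by
  classical
  by_cases hβ : β = constExp n (β 0)
  · rw [hβ, coeff_eigenStep_constExp, coeff_eigenStep_constExp]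
  · rw [coeff_eigenStep t w hβ, coeff_eigenStep t w hβ]
    congr 1
    have hfg : ∀ γ < β, MvPowerSeries.coeff γ (f - g) = 0 := fun γ hγ => by
      rw [map_sub, h γ hγ, sub_self]
    have h1 := coeff_weightedOp_of_forall_lt hq t w (f - g) β hfg
    have h2 := coeff_mul_of_forall_lt (ofNomeSeries (forcedEigenvalue q t w f)) (f - g) β hfg
    have h3 : MvPowerSeries.coeff β ((ofNomeSeries (forcedEigenvalue q t w f) -
        ofNomeSeries (forcedEigenvalue q t w g)) * g) = 0 := by
      rw [MvPowerSeries.coeff_mul]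
      refine Finset.sum_eq_zero fun x hx => ?_
      have hx' := Finset.HasAntidiagonal.mem_antidiagonal.1 hx
      rw [map_sub, coeff_ofNomeSeries, coeff_ofNomeSeries]
      split_ifs with hc
      · have hxc := eq_constExp hc
        rw [forcedEigenvalue, forcedEigenvalue, PowerSeries.coeff_mk, PowerSeries.coeff_mk]
        split_ifs with h0
        · rw [sub_self, zero_mul]
        -- The exponent `x.1` is constant and `β` is not, so only eigenvalue coefficients determined
        -- strictly below `β` enter.
        · have hlt : x.1 < β := by
            refine lt_of_le_of_ne (by rw [← hx']; exact le_self_add) ?_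
            intro heq
            rw [heq] at hxc
            exact hβ hxc
          rw [← hxc, ← map_sub, ← map_sub, coeff_weightedOp_of_forall_lt hq t w (f - g) x.1
            fun γ hγ => hfg γ (hγ.trans hlt), hfg _ hlt, mul_zero, zero_mul]
      · rw [sub_self, zero_mul]
    -- The forced eigenvalue has constant term `diagEntry q w 0` for every `f`, normalized or not,
    -- so the diagonal contributions cancel.
    rw [constantCoeff_ofNomeSeries, forcedEigenvalue, PowerSeries.coeff_mk, if_pos rfl] at h2
    rw [← forcedEigenvalue] at h2
    rw [map_sub, map_sub, map_sub] at h1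
    rw [mul_sub, map_sub, map_sub] at h2
    rw [sub_mul, map_sub] at h3
    linear_combination h2 + h3 - h1

variable {w} (hw : IsNondegenerate q w)
include hw

theorem eigenStep_eq_iff {f : AsympSeries n} :
    eigenStep q t w f = f ↔ IsNormalized f ∧
      weightedOp q t w f = ofNomeSeries (forcedEigenvalue q t w f) * f := by
  constructor
  · intro hf
    have hnorm : IsNormalized f := fun k => by
      rw [← coeff_eigenStep_constExp (q := q) t w f k, hf]
    refine ⟨hnorm, ?_⟩
    ext β
    by_cases hβ : β = constExp n (β 0)
    · rw [hβ, hnorm.coeff_constExp_mul, forcedEigenvalue, PowerSeries.coeff_mk]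
      split_ifs with h0
      · rw [h0, constExp_zero, coeff_weightedOp_of_forall_lt hq t w f 0 fun γ hγ =>
          absurd hγ not_lt_zero, ← constExp_zero, hnorm 0, expo_constExp, if_pos rfl, mul_one]
      · rfl
    · have h1 := coeff_eigenStep (q := q) t w hβ f
      rw [hf] at h1
      have h2 := sub_ne_zero.2 (hw β hβ)
      rw [eq_inv_mul_iff_mul_eq₀ h2] at h1
      linear_combination h1
  · rintro ⟨hnorm, hf⟩
    ext β
    by_cases hβ : β = constExp n (β 0)
    · rw [hβ, coeff_eigenStep_constExp, hnorm]
    · rw [coeff_eigenStep t w hβ, ← hf, sub_self, zero_add,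
        inv_mul_cancel_left₀ (sub_ne_zero.2 (hw β hβ))]

theorem existsUnique_eigenStep : ∃! f : AsympSeries n, eigenStep q t w f = f :=
  existsUnique_fixed_point (eigenStep q t w) fun f g β h => eigenStep_congr hq t w f g β h

theorem exists_eigenfunction : ∃ (f : AsympSeries n) (ε : PowerSeries ℂ), IsNormalized f ∧
    weightedOp q t w f = ofNomeSeries ε * f ∧ PowerSeries.coeff 0 ε = diagEntry q w 0 := by
  obtain ⟨f, hf, -⟩ := existsUnique_eigenStep hq t hw
  have := (eigenStep_eq_iff hq t hw).1 hf
  exact ⟨f, forcedEigenvalue q t w f, this.1, this.2, by simp [forcedEigenvalue]⟩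

omit hw in
theorem eq_forcedEigenvalue {f : AsympSeries n} (hf : IsNormalized f) {ε : PowerSeries ℂ}
    (h : weightedOp q t w f = ofNomeSeries ε * f) : ε = forcedEigenvalue q t w f := by
  ext k
  have h1 := hf.coeff_constExp_mul ε k
  rw [← h] at h1
  rw [forcedEigenvalue, PowerSeries.coeff_mk, ← h1]
  split_ifs with h0
  · rw [h0, constExp_zero, coeff_weightedOp_of_forall_lt hq t w f 0 fun γ hγ =>
      absurd hγ not_lt_zero, ← constExp_zero, hf 0, expo_constExp, if_pos rfl, mul_one]
  · rfl

theorem eigenfunction_unique {f g : AsympSeries n} (hf : IsNormalized f) (hg : IsNormalized g)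
    {ε η : PowerSeries ℂ} (hfε : weightedOp q t w f = ofNomeSeries ε * f)
    (hgη : weightedOp q t w g = ofNomeSeries η * g) : f = g := by
  refine (existsUnique_eigenStep hq t hw).unique ((eigenStep_eq_iff hq t hw).2 ⟨hf, ?_⟩)
    ((eigenStep_eq_iff hq t hw).2 ⟨hg, ?_⟩)
  · rw [← eq_forcedEigenvalue hq t hf hfε, hfε]
  · rw [← eq_forcedEigenvalue hq t hg hgη, hgη]

/-- Subtracting from `g` the multiple of `f` with the same constant term in `x` leaves an
eigenvector with no powers of `p`; nondegeneracy kills its other coefficients in turn. Consequently,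
operators commuting with this one have `f` as an eigenfunction. -/
theorem eigenspace_eq {f g : AsympSeries n} (hf : IsNormalized f) {ε : PowerSeries ℂ}
    (hfε : weightedOp q t w f = ofNomeSeries ε * f)
    (hgε : weightedOp q t w g = ofNomeSeries ε * g) :
    ∃ η : PowerSeries ℂ, g = ofNomeSeries η * f := by
  set η : PowerSeries ℂ := PowerSeries.mk fun k => MvPowerSeries.coeff (constExp n k) g with hη
  refine ⟨η, ?_⟩
  set h := g - ofNomeSeries η * f with hh
  have hh0 : ∀ k, MvPowerSeries.coeff (constExp n k) h = 0 := fun k => by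
    rw [hh, map_sub, hf.coeff_constExp_mul, hη, PowerSeries.coeff_mk, sub_self]
  have hhε : weightedOp q t w h = ofNomeSeries ε * h := by
    rw [hh, map_sub, weightedOp_ofNomeSeries_mul hq, hfε, hgε]
    ring
  have hε : PowerSeries.coeff 0 ε = diagEntry q w 0 := by
    rw [eq_forcedEigenvalue hq t hf hfε, forcedEigenvalue, PowerSeries.coeff_mk, if_pos rfl]
  have hzero : ∀ β, MvPowerSeries.coeff β h = 0 := by
    intro β
    induction β using WellFoundedLT.induction with
    | _ β ih =>
      by_cases hβ : β = constExp n (β 0)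
      · rw [hβ]; exact hh0 _
      · have h1 := congrArg (MvPowerSeries.coeff β) hhε
        rw [coeff_weightedOp_of_forall_lt hq t w h β ih, coeff_mul_of_forall_lt _ h β ih,
          constantCoeff_ofNomeSeries, hε] at h1
        have h2 := sub_ne_zero.2 (hw β hβ)
        refine (mul_eq_zero.1 ?_).resolve_left h2
        linear_combination h1
  have : h = 0 := MvPowerSeries.ext hzero
  exact sub_eq_zero.1 this

end Triangular

/-! ### Commutativity of all the operators; existence and uniqueness of the solution -/

section Genericity

variable {n : ℕ} [NeZero n]

theorem zpow_injective_of_norm_lt_one {q : ℂ} (hq : q ≠ 0) (hq1 : ‖q‖ < 1) :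
    Function.Injective fun m : ℤ => q ^ m := by
  intro l m h
  have h1 : ‖q‖ ^ l = ‖q‖ ^ m := by
    rw [← norm_zpow, ← norm_zpow]; exact congrArg norm h
  exact zpow_right_injective₀ (norm_pos_iff.2 hq) hq1.ne h1

/-- A property of complex numbers that fails only at the roots of countably many nonzero
polynomials holds infinitely often. -/
theorem infinite_setOf_eval_ne_zero {α : Type*} [Countable α] (p : α → Polynomial ℂ)
    (hp : ∀ a, p a ≠ 0) : {v : ℂ | ∀ a, (p a).eval v ≠ 0}.Infinite := by
  intro hfin
  have hc : {v : ℂ | ∀ a, (p a).eval v ≠ 0}ᶜ.Countable := by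
    have : {v : ℂ | ∀ a, (p a).eval v ≠ 0}ᶜ = ⋃ a, {v | (p a).IsRoot v} := by
      ext v; simp
    rw [this]
    exact Set.countable_iUnion fun a => (Polynomial.finite_setOfPred_isRoot (hp a)).countable
  have huniv := hfin.countable.union hc
  rw [Set.union_compl_self] at huniv
  exact not_countable_complex huniv

variable {q : ℂ}

/-- The point `(q ^ (l_i) s_i)`. -/
noncomputable def scaleParam (q : ℂ) (s : Fin n → ℂ) (l : Fin n → ℤ) (i : Fin n) : ℂ := s i * q ^ l i

/-- The eigenvalues of the first operator separate all the weights. -/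
def IsSeparating (q : ℂ) (s : Fin n → ℂ) : Prop :=
  ∀ l m : Fin n → ℤ, l ≠ m → ∑ i, s i * q ^ l i ≠ ∑ i, s i * q ^ m i

theorem IsSeparating.scaleParam (hq : q ≠ 0) {s : Fin n → ℂ} (hs : IsSeparating q s)
    (k : Fin n → ℤ) : IsSeparating q (scaleParam q s k) := by
  intro l m hlm
  simp only [Ruijsenaars.scaleParam, mul_assoc, ← zpow_add₀ hq]
  exact hs (fun i => k i + l i) (fun i => k i + m i) fun h => hlm (funext fun i => by
    have := congrFun h i
    simpa using this)

theorem weight_scaleParam (hq : q ≠ 0) (s : Fin n → ℂ) (l : Fin n → ℤ) (r : ℕ)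
    (I : Finset (Fin n)) :
    weight (scaleParam q s l) r I = weight s r I * q ^ (∑ i, ind I i * l i) := by
  unfold weight
  split_ifs
  · simp only [scaleParam, Finset.prod_mul_distrib, prod_zpow_eq hq]
    simp [ind]
  · rw [zero_mul]

theorem diagEntry_weight (hq : q ≠ 0) (s : Fin n → ℂ) (r : ℕ) (l : Fin n → ℤ) :
    diagEntry q (weight s r) l = ∑ I, weight (scaleParam q s l) r I := by
  simp only [diagEntry, weight_scaleParam hq]

theorem diagEntry_weight_one (hq : q ≠ 0) (s : Fin n → ℂ) (l : Fin n → ℤ) :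
    diagEntry q (weight s 1) l = ∑ i, s i * q ^ l i := by
  rw [diagEntry_weight hq]
  simp only [weight]
  rw [← Finset.sum_filter]
  have : (Finset.univ.filter fun I : Finset (Fin n) => I.card = 1) =
      (Finset.univ : Finset (Fin n)).powersetCard 1 := by
    ext I; simp [Finset.mem_powersetCard]
  rw [this, Finset.powersetCard_one, Finset.sum_map]
  simp [scaleParam]

theorem IsSeparating.isNondegenerate (hq : q ≠ 0) {s : Fin n → ℂ} (hs : IsSeparating q s) :
    IsNondegenerate q (weight s 1) := by
  intro β hβ
  rw [diagEntry_weight_one hq, diagEntry_weight_one hq]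
  exact hs _ _ fun h => hβ (eq_constExp_of_expo_eq_zero h)

/-- The perturbations `v ^ (i + 1)` have distinct degrees, so each of the countably many conditions
is a polynomial in `v` with a nonzero coefficient `q ^ l k - q ^ m k`. The curve passes through `s`
at `v = 0`. -/
theorem exists_infinite_isSeparating (hq : q ≠ 0) (hq1 : ‖q‖ < 1) (s : Fin n → ℂ) :
    {v : ℂ | IsSeparating q fun i => s i + v ^ (i.val + 1)}.Infinite := by
  let α := {x : (Fin n → ℤ) × (Fin n → ℤ) // x.1 ≠ x.2}
  let p : α → Polynomial ℂ := fun x => ∑ i : Fin n,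
    (Polynomial.C (s i) + Polynomial.X ^ (i.val + 1)) *
      Polynomial.C (q ^ x.1.1 i - q ^ x.1.2 i)
  have hp : ∀ x, p x ≠ 0 := by
    rintro ⟨⟨l, m⟩, hlm⟩ h0
    obtain ⟨k, hk⟩ := Function.ne_iff.1 hlm
    have h1 := congrArg (fun P => Polynomial.coeff P (k.val + 1)) h0
    simp only [p, Polynomial.finsetSum_coeff, Polynomial.coeff_mul_C, Polynomial.coeff_add,
      Polynomial.coeff_C_succ, Polynomial.coeff_X_pow, Polynomial.coeff_zero, zero_add,
      add_left_inj, ite_mul, one_mul, zero_mul, ← Fin.ext_iff] at h1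
    rw [Finset.sum_ite_eq, if_pos (Finset.mem_univ _)] at h1
    exact hk (zpow_injective_of_norm_lt_one hq hq1 (sub_eq_zero.1 h1))
  refine (infinite_setOf_eval_ne_zero p hp).mono fun v hv l m hlm heq => ?_
  apply hv ⟨(l, m), hlm⟩
  simp only [p, Polynomial.eval_finsetSum, Polynomial.eval_mul, Polynomial.eval_add,
    Polynomial.eval_C, Polynomial.eval_pow, Polynomial.eval_X, mul_sub, Finset.sum_sub_distrib]
  exact sub_eq_zero.2 heq

/-- The coefficient of `T^I T^J` in a commutator. -/
noncomputable def commCoeff (q t : ℂ) (I J : Finset (Fin n)) : AsympSeries n :=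
  opCoeff t I * shiftHom q (ind I) (opCoeff t J) - opCoeff t J * shiftHom q (ind J) (opCoeff t I)

/-- The commutator of the operators of orders `a` and `b`, applied to `1`. -/
noncomputable def commSymbol (q t : ℂ) (s : Fin n → ℂ) (a b : ℕ) : AsympSeries n :=
  ∑ I, ∑ J, MvPowerSeries.C (weight s a I * weight s b J) * commCoeff q t I J

theorem coeff_commSymbol (t : ℂ) (s : Fin n → ℂ) (a b : ℕ) (γ : Fin n →₀ ℕ) :
    MvPowerSeries.coeff γ (commSymbol q t s a b) = ∑ I, ∑ J,
      weight s a I * weight s b J * MvPowerSeries.coeff γ (commCoeff q t I J) := by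
  simp only [commSymbol, map_sum, MvPowerSeries.coeff_C_mul]

theorem commutator_eq (hq : q ≠ 0) (t : ℂ) (s : Fin n → ℂ) (a b : ℕ) (f : AsympSeries n) :
    weightedOp q t (weight s a) (weightedOp q t (weight s b) f) -
      weightedOp q t (weight s b) (weightedOp q t (weight s a) f) =
    ∑ I, ∑ J, MvPowerSeries.C (weight s a I * weight s b J) * commCoeff q t I J *
      shiftHom q (ind I + ind J) f := by
  rw [weightedOp_weightedOp hq, weightedOp_weightedOp hq]
  conv_lhs => rw [Finset.sum_comm (s := Finset.univ) (t := Finset.univ)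
    (f := fun I J => MvPowerSeries.C (weight s b I * weight s a J) *
      (opCoeff t I * shiftHom q (ind I) (opCoeff t J)) * shiftHom q (ind I + ind J) f)]
  rw [← Finset.sum_sub_distrib]
  refine Finset.sum_congr rfl fun I _ => ?_
  rw [← Finset.sum_sub_distrib]
  refine Finset.sum_congr rfl fun J _ => ?_
  rw [commCoeff, add_comm (ind J), mul_comm (weight s b J)]
  ring

/-- On a monomial of exponent `l` in `x`, the shifts amount to replacing `s_i` by `s_i q ^ l_i`. The
symbols at all scaled parameters thus determine the commutator. -/
theorem coeff_commutator (hq : q ≠ 0) (t : ℂ) (s : Fin n → ℂ) (a b : ℕ) (f : AsympSeries n)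
    (γ : Fin n →₀ ℕ) :
    MvPowerSeries.coeff γ (weightedOp q t (weight s a) (weightedOp q t (weight s b) f) -
      weightedOp q t (weight s b) (weightedOp q t (weight s a) f)) =
    ∑ x ∈ Finset.HasAntidiagonal.antidiagonal γ,
      MvPowerSeries.coeff x.1 (commSymbol q t (scaleParam q s (expo x.2)) a b) *
        MvPowerSeries.coeff x.2 f := by
  classical
  rw [commutator_eq hq]
  simp only [map_sum, coeff_commSymbol, Finset.sum_mul]
  conv_rhs => rw [Finset.sum_comm]
  refine Finset.sum_congr rfl fun I _ => ?_
  conv_rhs => rw [Finset.sum_comm]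
  refine Finset.sum_congr rfl fun J _ => ?_
  have : ∀ g : AsympSeries n, MvPowerSeries.coeff γ
      (MvPowerSeries.C (weight s a I * weight s b J) * g) =
      weight s a I * weight s b J * MvPowerSeries.coeff γ g := fun g => by
    rw [MvPowerSeries.coeff_C_mul]
  rw [mul_assoc, this, MvPowerSeries.coeff_mul, Finset.mul_sum]
  refine Finset.sum_congr rfl fun x _ => ?_
  rw [coeff_shiftHom hq, weight_scaleParam hq, weight_scaleParam hq]
  simp only [Pi.add_apply, add_mul, Finset.sum_add_distrib, zpow_add₀ hq]
  ring

/-- The eigenfunction of `𝓔^{(1)}` is a joint eigenfunction, so the commutator annihilates it. In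
the coefficient at `γ`, the terms with smaller symbol exponent vanish by induction, the separating
condition being stable under scaling; the remaining one is the symbol at `s` times the leading
coefficient `1`. -/
theorem commSymbol_eq_zero_of_isSeparating (hq : q ≠ 0) (hq1 : q ≠ 1) {t : ℂ} (ht : t ≠ 0)
    (a b : ℕ) (γ : Fin n →₀ ℕ) : ∀ s : Fin n → ℂ, IsSeparating q s →
      MvPowerSeries.coeff γ (commSymbol q t s a b) = 0 := by
  classical
  induction γ using WellFoundedLT.induction with
  | _ γ ih =>
    intro s hs
    obtain ⟨f, ε, hf, hfε, -⟩ := exists_eigenfunction hq t (hs.isNondegenerate hq)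
    have hr : ∀ r, ∃ η : PowerSeries ℂ, weightedOp q t (weight s r) f = ofNomeSeries η * f := by
      intro r
      refine eigenspace_eq hq t (hs.isNondegenerate hq) hf hfε ?_
      rw [← modifiedOp_eq_weightedOp hq, ← modifiedOp_eq_weightedOp hq,
        modifiedOp_one_comm hq hq1 ht, modifiedOp_eq_weightedOp hq, modifiedOp_eq_weightedOp hq,
        hfε, weightedOp_ofNomeSeries_mul hq, modifiedOp_eq_weightedOp hq]
    obtain ⟨η, hη⟩ := hr a
    obtain ⟨ζ, hζ⟩ := hr b
    have h0 := coeff_commutator hq t s a b f γ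
    rw [hη, hζ, weightedOp_ofNomeSeries_mul hq, weightedOp_ofNomeSeries_mul hq, hη, hζ,
      mul_left_comm, sub_self, map_zero, Finset.sum_eq_single (γ, 0)] at h0
    · have hf0 := hf 0
      rw [constExp_zero, if_pos rfl] at hf0
      have hs0 : scaleParam q s (expo (0 : Fin n →₀ ℕ)) = s := by
        funext i; simp [scaleParam, expo]
      simp only [hf0, mul_one, hs0] at h0
      exact h0.symm
    · rintro ⟨α, β⟩ hx hne
      have hx' := Finset.HasAntidiagonal.mem_antidiagonal.1 hx
      simp only at hx' ⊢
      have hβ : β ≠ 0 := by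
        rintro rfl
        exact hne (by rw [← hx', add_zero])
      rw [ih α (add_eq_lt ((add_comm β α).trans hx') hβ) _ (hs.scaleParam hq _), zero_mul]
    · intro h
      exact absurd (Finset.HasAntidiagonal.mem_antidiagonal.2 (add_zero γ)) h

theorem commSymbol_eq_zero (hq : q ≠ 0) (hq1 : ‖q‖ < 1) {t : ℂ} (ht : t ≠ 0) (s : Fin n → ℂ)
    (a b : ℕ) : commSymbol q t s a b = 0 := by
  have hq1' : q ≠ 1 := by rintro rfl; simp at hq1
  ext γ
  let W : ℕ → Finset (Fin n) → Polynomial ℂ := fun r I =>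
    if I.card = r then ∏ i ∈ I, (Polynomial.C (s i) + Polynomial.X ^ (i.val + 1)) else 0
  let P : Polynomial ℂ := ∑ I, ∑ J, W a I * W b J *
    Polynomial.C (MvPowerSeries.coeff γ (commCoeff q t I J))
  have hW : ∀ v r I, (W r I).eval v = weight (fun i => s i + v ^ (i.val + 1)) r I := by
    intro v r I
    simp only [W, weight]
    split_ifs
    · simp [Polynomial.eval_prod]
    · simp
  have hP : ∀ v, P.eval v =
      MvPowerSeries.coeff γ (commSymbol q t (fun i => s i + v ^ (i.val + 1)) a b) := by
    intro v
    simp only [P, Polynomial.eval_finsetSum, Polynomial.eval_mul, hW, Polynomial.eval_C,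
      coeff_commSymbol]
  have hP0 : P = 0 := by
    refine Polynomial.eq_zero_of_infinite_isRoot P
      ((exists_infinite_isSeparating hq hq1 s).mono fun v hv => ?_)
    change P.eval v = 0
    rw [hP]
    exact commSymbol_eq_zero_of_isSeparating hq hq1' ht a b γ _ hv
  -- At `v = 0` the perturbed parameters are the given `s`, which need not be separating.
  have h0 := hP 0
  rw [hP0] at h0
  simpa using h0.symm

theorem weightedOp_weight_comm (hq : q ≠ 0) (hq1 : ‖q‖ < 1) {t : ℂ} (ht : t ≠ 0) (s : Fin n → ℂ)
    (a b : ℕ) (f : AsympSeries n) :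
    weightedOp q t (weight s a) (weightedOp q t (weight s b) f) =
      weightedOp q t (weight s b) (weightedOp q t (weight s a) f) := by
  rw [← sub_eq_zero]
  ext γ
  rw [coeff_commutator hq]
  simp [commSymbol_eq_zero hq hq1 ht]

/-- The weights of the linear combination of the operators with coefficients `c`. -/
noncomputable def combWeight (s : Fin n → ℂ) (c : ℕ → ℂ) (I : Finset (Fin n)) : ℂ :=
  ∑ r ∈ Finset.Icc 1 n, c r * weight s r I

theorem weightedOp_combWeight (t : ℂ) (s : Fin n → ℂ) (c : ℕ → ℂ) (f : AsympSeries n) :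
    weightedOp q t (combWeight s c) f =
      ∑ r ∈ Finset.Icc 1 n, c r • weightedOp q t (weight s r) f := by
  simp only [weightedOp_apply, combWeight, map_sum, Finset.sum_mul, Finset.smul_sum,
    MvPowerSeries.smul_eq_C_mul, map_mul]
  rw [Finset.sum_comm]
  simp only [mul_assoc]

/-- Vieta's formula; the term `u ^ n` comes from the empty set, which the operators with `r ≥ 1`
omit. -/
theorem prod_sub_eq_diagEntry (hq : q ≠ 0) (s : Fin n → ℂ) (u : ℂ) (l : Fin n → ℤ) :
    ∏ i, (u - s i * q ^ l i) =
      diagEntry q (combWeight s fun r => (-1) ^ r * u ^ (n - r)) l + u ^ n := by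
  have h1 : ∏ i, (u - s i * q ^ l i) =
      ∑ I : Finset (Fin n), (-1) ^ I.card * u ^ (n - I.card) * ∏ i ∈ I, (s i * q ^ l i) := by
    simp only [sub_eq_neg_add]
    rw [Finset.prod_add, Finset.powerset_univ]
    refine Finset.sum_congr rfl fun I _ => ?_
    rw [Finset.prod_neg, Finset.prod_const, Finset.card_univ_sdiff, Fintype.card_fin]
    ring
  have h2 : ∀ I : Finset (Fin n),
      (-1) ^ I.card * u ^ (n - I.card) * ∏ i ∈ I, (s i * q ^ l i) =
        combWeight s (fun r => (-1) ^ r * u ^ (n - r)) I * q ^ (∑ i, ind I i * l i) +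
          if I = ∅ then u ^ n else 0 := by
    intro I
    have hprod : ∏ i ∈ I, (s i * q ^ l i) = (∏ i ∈ I, s i) * q ^ (∑ i, ind I i * l i) := by
      rw [Finset.prod_mul_distrib, prod_zpow_eq hq]
      simp [ind]
    by_cases hI : I = ∅
    · subst hI
      have : combWeight s (fun r => (-1) ^ r * u ^ (n - r)) ∅ = 0 := by
        refine Finset.sum_eq_zero fun r hr => ?_
        have := (Finset.mem_Icc.1 hr).1
        rw [weight, if_neg (by simp; omega), mul_zero]
      simp [this]
    · have hcard : I.card ∈ Finset.Icc 1 n := by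
        rw [Finset.mem_Icc]
        exact ⟨Finset.card_pos.2 (Finset.nonempty_iff_ne_empty.2 hI), by
          simpa using Finset.card_le_univ I⟩
      rw [if_neg hI, add_zero, combWeight, Finset.sum_eq_single I.card]
      · rw [weight, if_pos rfl, hprod]; ring
      · intro r _ hr
        rw [weight, if_neg (Ne.symm hr), mul_zero]
      · exact fun h => absurd hcard h
  rw [h1, Finset.sum_congr rfl fun I _ => h2 I, Finset.sum_add_distrib, diagEntry]
  simp

/-- The genericity condition on the spectral parameters. -/
def IsGeneric (q : ℂ) (s : Fin n → ℂ) : Prop :=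
  (∀ i, s i ≠ 0) ∧ ∀ i j : Fin n, i ≠ j → ∀ m : ℤ, m ≠ 0 → s j ≠ s i * q ^ m

/-- If `∏ (u - s_i q ^ l_i)` and `∏ (u - s_i)` agree as polynomials in `u`, each `s_i q ^ l_i` is
some `s_j`, and genericity forces `l_i = 0`. For `l ≠ 0` they thus differ, and one value of `u`
distinguishes them for all the countably many `l`. -/
theorem IsGeneric.exists_isNondegenerate (hq : q ≠ 0) (hq1 : ‖q‖ < 1) {s : Fin n → ℂ}
    (hs : IsGeneric q s) : ∃ c : ℕ → ℂ, IsNondegenerate q (combWeight s c) := by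
  let α := {l : Fin n → ℤ // l ≠ 0}
  let D : (Fin n → ℤ) → Polynomial ℂ := fun l =>
    ∏ i : Fin n, (Polynomial.X - Polynomial.C (s i * q ^ l i))
  let p : α → Polynomial ℂ := fun l => D l - D 0
  have hp : ∀ l, p l ≠ 0 := by
    rintro ⟨l, hl⟩ h0
    apply hl
    funext i
    have h1 := congrArg (Polynomial.eval (s i * q ^ l i)) h0
    have h2 : (D l).eval (s i * q ^ l i) = 0 := by
      simp only [D, Polynomial.eval_prod]
      exact Finset.prod_eq_zero (Finset.mem_univ i) (by simp)
    simp only [p, Polynomial.eval_sub, h2, zero_sub, Polynomial.eval_zero, neg_eq_zero] at h1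
    simp only [D, Polynomial.eval_prod, Pi.zero_apply, zpow_zero, mul_one, Polynomial.eval_sub,
      Polynomial.eval_X, Polynomial.eval_C, Finset.prod_eq_zero_iff, Finset.mem_univ, true_and,
      sub_eq_zero] at h1
    obtain ⟨j, hj⟩ := h1
    by_contra hli
    by_cases hij : i = j
    · subst hij
      have : q ^ l i = q ^ (0 : ℤ) := by
        rw [zpow_zero]
        exact mul_left_cancel₀ (hs.1 i) (by rw [hj, mul_one])
      exact hli (zpow_injective_of_norm_lt_one hq hq1 this)
    · exact hs.2 i j hij (l i) hli hj.symm
  obtain ⟨u, hu⟩ := (infinite_setOf_eval_ne_zero p hp).nonempty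
  refine ⟨fun r => (-1) ^ r * u ^ (n - r), fun β hβ heq => ?_⟩
  have hne : expo β ≠ 0 := fun h => hβ (eq_constExp_of_expo_eq_zero h)
  apply hu ⟨expo β, hne⟩
  have e1 := prod_sub_eq_diagEntry hq s u (expo β)
  have e2 := prod_sub_eq_diagEntry hq s u 0
  rw [heq, ← e2] at e1
  simp only [p, D, Polynomial.eval_sub, Polynomial.eval_prod, Polynomial.eval_X, Polynomial.eval_C]
  exact sub_eq_zero.2 e1

theorem isNormalizedSolution_iff (hq : q ≠ 0) (t : ℂ) (s : Fin n → ℂ) (f : AsympSeries n)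
    (ε : ℕ → PowerSeries ℂ) : IsNormalizedSolution q t s f ε ↔ IsNormalized f ∧
      ∀ r ∈ Finset.Icc 1 n, weightedOp q t (weight s r) f = ofNomeSeries (ε r) * f := by
  constructor
  · rintro ⟨h1, h2⟩
    exact ⟨h2, fun r hr => by rw [← modifiedOp_eq_weightedOp hq]; exact h1 r hr⟩
  · rintro ⟨h1, h2⟩
    exact ⟨fun r hr => by rw [modifiedOp_eq_weightedOp hq]; exact h2 r hr, h1⟩

theorem IsGeneric.exists_isNormalizedSolution (hq : q ≠ 0) (hq1 : ‖q‖ < 1) {t : ℂ} (ht : t ≠ 0)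
    {s : Fin n → ℂ} (hs : IsGeneric q s) : ∃ f ε, IsNormalizedSolution q t s f ε := by
  obtain ⟨c, hc⟩ := hs.exists_isNondegenerate hq hq1
  obtain ⟨f, ε, hf, hfε, -⟩ := exists_eigenfunction hq t hc
  have hr : ∀ r, ∃ η : PowerSeries ℂ, weightedOp q t (weight s r) f = ofNomeSeries η * f := by
    intro r
    refine eigenspace_eq hq t hc hf hfε ?_
    rw [← weightedOp_ofNomeSeries_mul hq, ← hfε, weightedOp_combWeight, weightedOp_combWeight,
      map_sum]
    refine Finset.sum_congr rfl fun k _ => ?_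
    rw [map_smul, weightedOp_weight_comm hq hq1 ht]
  choose η hη using hr
  exact ⟨f, η, (isNormalizedSolution_iff hq t s f η).2 ⟨hf, fun r _ => hη r⟩⟩

/-- The inclusion of `ℂ⟦p⟧` as a linear map. -/
noncomputable def ofNomeLinear (n : ℕ) [NeZero n] : PowerSeries ℂ →ₗ[ℂ] AsympSeries n where
  toFun := ofNomeSeries
  map_add' ε η := by
    ext β
    simp only [map_add, coeff_ofNomeSeries]
    split_ifs <;> simp
  map_smul' c ε := by
    ext β
    simp only [map_smul, coeff_ofNomeSeries, RingHom.id_apply]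
    split_ifs <;> simp

theorem IsGeneric.isNormalizedSolution_unique (hq : q ≠ 0) (hq1 : ‖q‖ < 1) {t : ℂ}
    {s : Fin n → ℂ} (hs : IsGeneric q s) {f g : AsympSeries n} {ε η : ℕ → PowerSeries ℂ}
    (hf : IsNormalizedSolution q t s f ε) (hg : IsNormalizedSolution q t s g η) :
    f = g ∧ ∀ r ∈ Finset.Icc 1 n, ε r = η r := by
  obtain ⟨c, hc⟩ := hs.exists_isNondegenerate hq hq1
  rw [isNormalizedSolution_iff hq] at hf hg
  have key : ∀ (f : AsympSeries n) (ε : ℕ → PowerSeries ℂ),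
      (∀ r ∈ Finset.Icc 1 n, weightedOp q t (weight s r) f = ofNomeSeries (ε r) * f) →
      weightedOp q t (combWeight s c) f =
        ofNomeSeries (∑ r ∈ Finset.Icc 1 n, c r • ε r) * f := by
    intro f ε h
    change _ = ofNomeLinear n _ * f
    rw [weightedOp_combWeight, map_sum, Finset.sum_mul]
    refine Finset.sum_congr rfl fun r hr => ?_
    rw [h r hr, map_smul, smul_mul_assoc]
    rfl
  have hfg : f = g := eigenfunction_unique hq t hc hf.1 hg.1 (key f ε hf.2) (key g η hg.2)
  subst hfg
  exact ⟨rfl, fun r hr => (eq_forcedEigenvalue hq t hf.1 (hf.2 r hr)).trans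
    (eq_forcedEigenvalue hq t hf.1 (hg.2 r hr)).symm⟩

end Genericity

/-! ### The rotation and its effect on operators, solutions and series -/

section Rotation

variable {n : ℕ} [NeZero n]

/-- The exponent `k ↦ β (k + 1)`. -/
noncomputable def rotateExp (n : ℕ) [NeZero n] : (Fin n →₀ ℕ) ≃ (Fin n →₀ ℕ) :=
  Finsupp.equivCongrLeft (Equiv.addRight (1 : Fin n)).symm

theorem rotateExp_apply (β : Fin n →₀ ℕ) (k : Fin n) : rotateExp n β k = β (k + 1) := rfl

theorem rotateExp_eq (β : Fin n →₀ ℕ) :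
    rotateExp n β = Finsupp.equivFunOnFinite.symm fun k : Fin n => β (k + 1) := by
  ext k
  rfl

/-- The substitution `z_k ↦ z_{k + 1}` as a ring homomorphism. -/
noncomputable def rotateHom (n : ℕ) [NeZero n] : AsympSeries n →+* AsympSeries n :=
  (MvPowerSeries.rename (Equiv.addRight (1 : Fin n)).toEmbedding : _ →ₐ[ℂ] _).toRingHom

theorem coeff_rotateHom (f : AsympSeries n) (β : Fin n →₀ ℕ) :
    MvPowerSeries.coeff β (rotateHom n f) = MvPowerSeries.coeff (rotateExp n β) f := by
  have h : β = Finsupp.embDomain (Equiv.addRight (1 : Fin n)).toEmbedding (rotateExp n β) := by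
    ext k
    obtain ⟨j, rfl⟩ := (Equiv.addRight (1 : Fin n)).surjective k
    exact (Finsupp.embDomain_apply_self (Equiv.addRight (1 : Fin n)).toEmbedding
      (rotateExp n β) j).symm
  conv_lhs => rw [h]
  exact MvPowerSeries.coeff_embDomain_rename _ _ _

theorem rotateHom_eq (f : AsympSeries n) : rotateHom n f = rotateSeries f := by
  ext β
  rw [coeff_rotateHom, rotateExp_eq]
  rfl

theorem rotateHom_C (c : ℂ) : rotateHom n (MvPowerSeries.C c) = MvPowerSeries.C c :=
  MvPowerSeries.rename_C _ c

theorem rotateHom_X (k : Fin n) :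
    rotateHom n (MvPowerSeries.X k) = MvPowerSeries.X (k + 1) :=
  MvPowerSeries.rename_X _ k

theorem rotateHom_nome : rotateHom n (nome n) = nome n := by
  simp only [nome, map_prod, rotateHom_X]
  exact Equiv.prod_comp (Equiv.addRight (1 : Fin n)) fun k => (MvPowerSeries.X k : AsympSeries n)

theorem rotateHom_xprod_cyc {i j : Fin n} (h : i ≠ j) :
    rotateHom n (xprod (cyc i j)) = xprod (cyc (i + 1) (j + 1)) := by
  simp only [xprod, map_prod, rotateHom_X]
  refine Finset.prod_bij (fun k _ => k + 1) (fun k hk => (add_one_mem_cyc_add_one h).2 hk)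
    (fun a _ b _ hab => add_right_cancel hab) (fun k hk => ?_) fun _ _ => rfl
  refine ⟨k - 1, (add_one_mem_cyc_add_one h).1 ?_, sub_add_cancel k 1⟩
  rwa [sub_add_cancel]

theorem rotateHom_pochhammer (a : AsympSeries n) :
    rotateHom n (pochhammer a) = pochhammer (rotateHom n a) := by
  refine map_pochhammer _ (fun _ => 1) (rotateExp n) (fun β => ?_) (fun f β => ?_)
    rotateHom_nome a
  · rw [Finsupp.degree_eq_sum, Finsupp.degree_eq_sum]
    exact Equiv.sum_comp (Equiv.addRight (1 : Fin n)) fun k => β k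
  · rw [coeff_rotateHom, one_mul]

theorem rotateHom_thetaPair (c : ℂ) {i j : Fin n} (h : i ≠ j) :
    rotateHom n (thetaPair c i j) = thetaPair c (i + 1) (j + 1) := by
  simp only [thetaPair, map_mul, rotateHom_pochhammer, rotateHom_C, rotateHom_xprod_cyc h,
    rotateHom_xprod_cyc h.symm]

theorem rotateHom_inv {f : AsympSeries n} (hf : MvPowerSeries.constantCoeff f = 1) :
    rotateHom n f⁻¹ = (rotateHom n f)⁻¹ := by
  have h0 : MvPowerSeries.constantCoeff (rotateHom n f) ≠ 0 := by
    rw [← MvPowerSeries.coeff_zero_eq_constantCoeff_apply, coeff_rotateHom,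
      show rotateExp n 0 = 0 from by ext; rfl, MvPowerSeries.coeff_zero_eq_constantCoeff_apply, hf]
    exact one_ne_zero
  rw [MvPowerSeries.eq_inv_iff_mul_eq_one h0, ← map_mul, MvPowerSeries.inv_mul_cancel, map_one]
  rw [hf]
  exact one_ne_zero

theorem rotateHom_pairCoeff (c d : ℂ) {i j : Fin n} (h : i ≠ j) :
    rotateHom n (pairCoeff c d i j) = pairCoeff c d (i + 1) (j + 1) := by
  rw [pairCoeff, map_mul, rotateHom_inv (constantCoeff_thetaPair d _ _), rotateHom_thetaPair _ h,
    rotateHom_thetaPair _ h, pairCoeff]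

/-- The set `{i + 1 | i ∈ I}`. -/
def rotateSet (n : ℕ) [NeZero n] : Finset (Fin n) ≃ Finset (Fin n) :=
  (Equiv.addRight (1 : Fin n)).finsetCongr

theorem add_one_mem_rotateSet {I : Finset (Fin n)} {i : Fin n} :
    i + 1 ∈ rotateSet n I ↔ i ∈ I :=
  Finset.mem_map' (Equiv.addRight (1 : Fin n)).toEmbedding

theorem card_rotateSet (I : Finset (Fin n)) : (rotateSet n I).card = I.card :=
  Finset.card_map _

theorem compl_rotateSet (I : Finset (Fin n)) : (rotateSet n I)ᶜ = rotateSet n Iᶜ := by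
  ext k
  obtain ⟨j, rfl⟩ := (Equiv.addRight (1 : Fin n)).surjective k
  change j + 1 ∈ _ ↔ j + 1 ∈ _
  simp only [Finset.mem_compl, add_one_mem_rotateSet]

theorem prod_rotateSet {M : Type*} [CommMonoid M] (I : Finset (Fin n)) (g : Fin n → M) :
    ∏ i ∈ rotateSet n I, g i = ∏ i ∈ I, g (i + 1) :=
  Finset.prod_map _ _ _

theorem rotateHom_opCoeff (t : ℂ) (I : Finset (Fin n)) :
    rotateHom n (opCoeff t I) = opCoeff t (rotateSet n I) := by
  rw [opCoeff_eq, opCoeff_eq, compl_rotateSet, prod_rotateSet, map_prod]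
  refine Finset.prod_congr rfl fun i hi => ?_
  rw [prod_rotateSet, map_prod]
  refine Finset.prod_congr rfl fun j hj => rotateHom_pairCoeff t 1 ?_
  rintro rfl
  exact Finset.mem_compl.1 hj hi

theorem rotateHom_qShift (q : ℂ) (I : Finset (Fin n)) (f : AsympSeries n) :
    rotateHom n (qShift q I f) = qShift q (rotateSet n I) (rotateHom n f) := by
  ext β
  rw [coeff_rotateHom]
  change (∏ i ∈ I, _) * _ = (∏ i ∈ rotateSet n I, _) * MvPowerSeries.coeff β (rotateHom n f)
  rw [prod_rotateSet, coeff_rotateHom]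
  rfl

/-- Reindexing by `I ↦ I + 1` matches the coefficients, the shifts and the weights, as `∏_{i ∈ I}
s_{i+1}` is the weight of the rotated set. -/
theorem rotateHom_modifiedOp (q t : ℂ) (s : Fin n → ℂ) (r : ℕ) (f : AsympSeries n) :
    rotateHom n (modifiedOp q t (rotateParam s) r f) = modifiedOp q t s r (rotateHom n f) := by
  simp only [modifiedOp, map_sum, map_mul, rotateHom_C, rotateHom_opCoeff, rotateHom_qShift]
  refine Finset.sum_bij (fun I _ => rotateSet n I) (fun I hI => ?_)
    (fun I _ J _ h => (rotateSet n).injective h) (fun J hJ => ?_) fun I _ => ?_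
  · simpa [Finset.mem_powersetCard, card_rotateSet] using hI
  · refine ⟨(rotateSet n).symm J, ?_, Equiv.apply_symm_apply _ _⟩
    have := card_rotateSet ((rotateSet n).symm J)
    rw [Equiv.apply_symm_apply] at this
    simpa [Finset.mem_powersetCard, this] using hJ
  · rw [prod_rotateSet]
    rfl

theorem rotateHom_ofNomeSeries (ε : PowerSeries ℂ) :
    rotateHom n (ofNomeSeries ε) = ofNomeSeries ε := by
  ext β
  rw [coeff_rotateHom]
  change (if ∀ i, β (i + 1) = β (0 + 1) then PowerSeries.coeff (β (0 + 1)) ε else 0) =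
    if ∀ i, β i = β 0 then PowerSeries.coeff (β 0) ε else 0
  by_cases h : ∀ i, β i = β 0
  · rw [if_pos h, if_pos fun i => by rw [h, h (0 + 1)], h (0 + 1)]
  · rw [if_neg h, if_neg fun h' => h fun i => ?_]
    rw [← sub_add_cancel i 1, h', ← h' (0 - 1), sub_add_cancel]

theorem IsNormalizedSolution.rotateHom {q t : ℂ} {s : Fin n → ℂ} {f : AsympSeries n}
    {ε : ℕ → PowerSeries ℂ} (h : IsNormalizedSolution q t (rotateParam s) f ε) :
    IsNormalizedSolution q t s (rotateHom n f) ε where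
  eigen r hr := by
    rw [← rotateHom_modifiedOp, h.eigen r hr, map_mul, rotateHom_ofNomeSeries]
  normalized k := by
    rw [coeff_rotateHom, ← h.normalized k, rotateExp_eq]
    rfl

theorem IsGeneric.rotateParam {q : ℂ} {s : Fin n → ℂ} (h : IsGeneric q s) :
    IsGeneric q (rotateParam s) :=
  ⟨fun i => h.1 (i + 1), fun i j hij => h.2 (i + 1) (j + 1) fun e => hij (add_right_cancel e)⟩

theorem isGeneric_of_lt {q : ℂ} {s : Fin n → ℂ} (hs0 : ∀ i, s i ≠ 0)
    (hs : ∀ i j : Fin n, i < j → ∀ m : ℤ, m ≠ 0 → s j / s i ≠ q ^ m) : IsGeneric q s := by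
  refine ⟨hs0, fun i j hij m hm h => ?_⟩
  rcases lt_or_gt_of_ne hij with hlt | hlt
  · exact hs i j hlt m hm (by rw [h, mul_div_cancel_left₀ _ (hs0 i)])
  · refine hs j i hlt (-m) (neg_ne_zero.2 hm) ?_
    rw [h, zpow_neg, div_mul_cancel_left₀ (hs0 i)]

theorem IsGeneric.rotateSeries_series {q t : ℂ} (hq : q ≠ 0) (hq1 : ‖q‖ < 1) (ht : t ≠ 0)
    {s : Fin n → ℂ} (hs : IsGeneric q s) :
    rotateSeries (series q t (Ruijsenaars.rotateParam s)) = series q t s ∧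
      ∀ r ∈ Finset.Icc 1 n, eigenvalue q t (Ruijsenaars.rotateParam s) r = eigenvalue q t s r := by
  rw [← rotateHom_eq]
  exact hs.isNormalizedSolution_unique hq hq1
    (isNormalizedSolution_series (hs.rotateParam.exists_isNormalizedSolution hq hq1 ht)).rotateHom
    (isNormalizedSolution_series (hs.exists_isNormalizedSolution hq hq1 ht))

theorem asympVar_rotatePoint {p : ℂ} (hp : p ≠ 0) (x : Fin n → ℂ) (k : Fin n) :
    asympVar p (rotatePoint p x) k = asympVar p x (k + 1) := by
  have key : ∀ m : Fin n, m + 1 ≠ 0 → rotatePoint p x m = x (m + 1) := fun m hm => if_neg hm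
  have key0 : ∀ m : Fin n, m + 1 = 0 → rotatePoint p x m = p * x 0 := fun m hm => if_pos hm
  by_cases hk : k = 0
  · subst hk
    rw [asympVar, if_pos rfl, key0 (-1) (neg_add_cancel 1), asympVar]
    -- This happens only for `n = 1`, where the first and the last index coincide.
    by_cases h1 : (0 : Fin n) + 1 = 0
    · have hm : (-1 : Fin n) = 0 := by rw [neg_eq_zero, ← zero_add (1 : Fin n), h1]
      rw [if_pos h1, key0 0 h1, hm, mul_div_mul_left _ _ hp]
    · rw [if_neg h1, key 0 h1, mul_div_mul_left _ _ hp, add_sub_cancel_right]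
  · rw [asympVar, if_neg hk, key (k - 1) (by rwa [sub_add_cancel]), sub_add_cancel, asympVar]
    by_cases h1 : k + 1 = 0
    · rw [if_pos h1, key0 k h1, eq_neg_of_add_eq_zero_left h1]
    · rw [if_neg h1, key k h1, add_sub_cancel_right]

theorem term_rotatePoint {q t : ℂ} {s : Fin n → ℂ}
    (h : rotateSeries (series q t (rotateParam s)) = series q t s) {p : ℂ} (hp : p ≠ 0)
    (x : Fin n → ℂ) (β : Fin n →₀ ℕ) :
    term q t (rotatePoint p x) (rotateParam s) p (rotateExp n β) = term q t x s p β := by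
  rw [term, term, ← h, ← rotateHom_eq, coeff_rotateHom]
  congr 1
  simp only [asympVar_rotatePoint hp, rotateExp_apply]
  exact Equiv.prod_comp (Equiv.addRight (1 : Fin n)) fun k => asympVar p x k ^ β k

end Rotation

end Ruijsenaars

theorem theorem2p7 {n : ℕ} [NeZero n] (q t : ℂ) (hq0 : q ≠ 0) (hq1 : ‖q‖ < 1) (ht : t ≠ 0)
    (s : Fin n → ℂ) (hs0 : ∀ i, s i ≠ 0)
    (hs : ∀ i j : Fin n, i < j → ∀ m : ℤ, m ≠ 0 → s j / s i ≠ q ^ m) :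
    -- the identity of formal power series
    Ruijsenaars.rotateSeries (Ruijsenaars.series q t (Ruijsenaars.rotateParam s)) =
      Ruijsenaars.series q t s ∧
    -- the identity of functions: the series converge absolutely at the same points, and agree
    (∀ (p : ℂ) (x : Fin n → ℂ), p ≠ 0 → (∀ i, x i ≠ 0) →
      (Summable (Ruijsenaars.term q t (Ruijsenaars.rotatePoint p x) (Ruijsenaars.rotateParam s) p) ↔
        Summable (Ruijsenaars.term q t x s p)) ∧
      Ruijsenaars.ruijsenaars q t (Ruijsenaars.rotatePoint p x) (Ruijsenaars.rotateParam s) p =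
        Ruijsenaars.ruijsenaars q t x s p) ∧
    -- the eigenvalues
    ∀ r ∈ Finset.Icc 1 n,
      Ruijsenaars.eigenvalue q t (Ruijsenaars.rotateParam s) r = Ruijsenaars.eigenvalue q t s r := by
  obtain ⟨h1, h3⟩ := (Ruijsenaars.isGeneric_of_lt hs0 hs).rotateSeries_series hq0 hq1 ht
  refine ⟨h1, fun p x hp _ => ?_, h3⟩
  have h2 := Ruijsenaars.term_rotatePoint h1 hp x
  constructor
  · rw [← (Ruijsenaars.rotateExp n).summable_iff]
    exact summable_congr h2
  -- Reindexing by a bijection of exponents preserves `tsum` without any convergence hypothesis; in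
  -- the divergent case both values are `0` by convention.
  · rw [Ruijsenaars.ruijsenaars, ← (Ruijsenaars.rotateExp n).tsum_eq]
    exact tsum_congr h2
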